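/- Let $n\ge 1$ and let $\mathfrak C=\{0,1\}^{\mathbb N}$ be the Cantor set. A basic dyadic block of $\mathfrak C^n$ is a product $w_1\mathfrak C\times\dots\times w_n\mathfrak C$ with finite binary words $w_i$ (equivalently, a product of basic dyadic intervals of the unit cube); a map takes the block given by $(w_i)$ affinely onto the block given by $(w_i')$ if it sends $(w_1s_1,\dots,w_ns_n)$ to $(w_1's_1,\dots,w_n's_n)$. A dyadic subdivision is a partition into basic dyadic blocks obtained from the whole cube by successively halving blocks in one of the $n$ coordinate directions; it is recorded by a finite binary tree with $n$ types of carets, one for each direction. The higher dimensional Thompson group $nV$ consists of the bijections of $\mathfrak C^n$ that map each block of some dyadic subdivision affinely onto a basic dyadic block. A tree-pair diagram for $x\in nV$ is a pair of such trees (source and target) with a bijection between their leaves, such that $x$ maps each block of the source subdivision affinely onto the corresponding block of the target subdivision. It is a grid diagram if the source is a grid, that is, the product of dyadic subdivisions, given by binary trees $T_1,\dots,T_n$, of the $n$ coordinates; its number of carets is that of its source tree, i.e. the number of blocks minus one. A grid diagram for $x$ is reduced if erasing any exposed caret (a caret both of whose children are leaves) of any $T_i$ yields a grid that is not the source of any grid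 diagram for $x$. In $2V$, with "vertical" carets halving the first and "horizontal" carets halving the second coordinate, let $R_k$ be the tree consisting of $k$ vertical carets, each but the first attached to the right leaf of the preceding one, with leaves numbered $0,\dots,k$ from left to right. Let $A_i$ (resp. $B_i$) be the element whose source tree is $R_{i+1}$ with an additional vertical (resp. horizontal) caret at leaf $i$, whose target tree is $R_{i+2}$, and which matches the leaves in left-to-right order; let $\Pi_i$ interchange the leaves $i,i+1$ of $R_{i+2}$ and $\overline\Pi_i$ interchange the leaves $i,i+1$ of $R_{i+1}$. Brin's generating set is $\Sigma=\{A_0,A_1,B_0,B_1,\Pi_0,\Pi_1,\overline\Pi_0,\overline\Pi_1\}$. **Theorem.** (1) $\Sigma$ generates $2V$ and every element of $2V$ has a reduced grid diagram. There is a constant $C>0$ such that for every $x\in 2V$, with $|x|$ its word length with respect to $\Sigma$ and $M(x)$ the number of carets of a reduced grid diagram for $x$, $$\log M(x)\le C\,|x|+C\qquad\text{and}\qquad |x|\le C\,M(x)\log M(x)+C ,$$ where $\log 0$ is read as $0$ (the case $x=1$). (2) For every $n\ge 1$ the group $nV$ is finitely generated, every element of $nV$ has a reduced grid diagram, and for every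 finite generating set $S$ of $nV$ there is a constant $C>0$ such that the same two inequalities hold for every $x\in nV$ and every reduced grid diagram for $x$, with $|x|$ the word length with respect to $S$ and $M(x)$ the number of carets of the diagram. -/

import Mathlib

namespace HigherThompson

/-! ### Words, blocks, and the Cantor model of the cube -/

/-- The `n`-dimensional cube in its Cantor model: each coordinate is given by its infinite binary
expansion (a point of the Cantor set). -/
abbrev Cube (n : ℕ) : Type := Fin n → Stream' Bool

/-- A basic dyadic block: the product of `n` basic dyadic intervals. The basic dyadic interval
`[(i-1)/2^k, i/2^k]` is given by the binary word of length `k` that all its points start with. -/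
abbrev Block (n : ℕ) : Type := Fin n → List Bool

/-- The affine identification of the cube with the block `b`, in every coordinate orientation
preserving: on binary expansions it prepends the word `b i` to the `i`-th coordinate. -/
def Block.embed {n : ℕ} (b : Block n) (s : Cube n) : Cube n := fun i => b i ++ₛ s i

/-- `f` maps the block `b` affinely (coordinatewise increasing) onto the block `c`. -/
def MapsBlock {n : ℕ} (f : Cube n → Cube n) (b c : Block n) : Prop :=
  ∀ s : Cube n, f (b.embed s) = c.embed s

/-! ### Dyadic subdivisions of the cube, given by trees with `n` types of carets -/

/-- A binary tree with `n` types of carets. A caret of type `i` halves a block in direction `i`. -/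
inductive DTree (n : ℕ) : Type
  | leaf : DTree n
  | caret (i : Fin n) (l r : DTree n) : DTree n

/-- The number of carets. -/
def DTree.carets {n : ℕ} : DTree n → ℕ
  | .leaf => 0
  | .caret _ l r => l.carets + r.carets + 1

/-- The block that corresponds to `b` when the cube is identified affinely with its lower
(`a = false`) or upper (`a = true`) half in direction `i`. -/
def Block.inHalf {n : ℕ} (i : Fin n) (a : Bool) (b : Block n) : Block n :=
  Function.update b i (a :: b i)

/-- The blocks of the subdivision given by a tree: its leaves, from left to right. -/
def DTree.leaves {n : ℕ} : DTree n → List (Block n)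
  | .leaf => [fun _ => []]
  | .caret i l r =>
      l.leaves.map (Block.inHalf i false) ++ r.leaves.map (Block.inHalf i true)

/-! ### The group `nV` -/

section Group

variable {n : ℕ}

theorem Block.embed_append (b w : Block n) (s : Cube n) :
    Block.embed (fun i => b i ++ w i) s = b.embed (w.embed s) := by
  funext i
  simp [Block.embed]

theorem MapsBlock.append {f : Cube n → Cube n} {b c : Block n} (h : MapsBlock f b c)
    (w : Block n) : MapsBlock f (fun i => b i ++ w i) (fun i => c i ++ w i) := by
  intro s
  rw [Block.embed_append, Block.embed_append, h]

theorem DTree.exists_leaf_prefix (t : DTree n) (b : Block n)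
    (hb : ∀ i, t.carets ≤ (b i).length) :
    ∃ c ∈ t.leaves, ∃ w : Block n, b = fun i => c i ++ w i := by
  induction t generalizing b with
  | leaf => exact ⟨fun _ => [], by simp [DTree.leaves], b, by simp⟩
  | caret i l r ihl ihr =>
    have key : ∀ (t : DTree n) (a : Bool) (tl : List Bool),
        (∀ b : Block n, (∀ i, t.carets ≤ (b i).length) →
          ∃ c ∈ t.leaves, ∃ w : Block n, b = fun i => c i ++ w i) →
        t.carets ≤ tl.length → (∀ j, t.carets ≤ (b j).length) → b i = a :: tl →
        ∃ c ∈ t.leaves.map (Block.inHalf i a), ∃ w : Block n, b = fun i => c i ++ w i := by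
      intro t a tl ih h1 h2 h3
      obtain ⟨c, hc, w, hw⟩ := ih (Function.update b i tl) (by
        intro j
        by_cases hj : j = i
        · subst hj; simpa using h1
        · simpa [Function.update_of_ne hj] using h2 j)
      refine ⟨_, List.mem_map_of_mem hc, w, ?_⟩
      funext j
      have hwj := congrFun hw j
      by_cases hj : j = i
      · subst hj
        simp only [Function.update_self] at hwj
        simp [Block.inHalf, h3, hwj]
      · simp only [Function.update_of_ne hj] at hwj
        simp [Block.inHalf, Function.update_of_ne hj, hwj]
    have hi := hb i
    simp only [DTree.carets] at hb hi
    rcases hbi : b i with _ | ⟨a, tl⟩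
    · simp [hbi] at hi
    · simp only [hbi, List.length_cons] at hi
      simp only [DTree.leaves, List.mem_append]
      cases a
      · obtain ⟨c, hc, h⟩ := key l false tl ihl (by omega) (fun j => by have := hb j; omega) hbi
        exact ⟨c, Or.inl hc, h⟩
      · obtain ⟨c, hc, h⟩ := key r true tl ihr (by omega) (fun j => by have := hb j; omega) hbi
        exact ⟨c, Or.inr hc, h⟩

/-- The tree that subdivides every block in the directions of the list, one after the other. -/
def DTree.uniform : List (Fin n) → DTree n
  | [] => .leaf
  | i :: L => .caret i (DTree.uniform L) (DTree.uniform L)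

theorem DTree.length_of_mem_uniform (L : List (Fin n)) (b : Block n)
    (hb : b ∈ (DTree.uniform L).leaves) (j : Fin n) : (b j).length = L.count j := by
  induction L generalizing b with
  | nil =>
    simp only [DTree.uniform, DTree.leaves, List.mem_singleton] at hb
    simp [hb]
  | cons i L ih =>
    simp only [DTree.uniform, DTree.leaves, List.mem_append, List.mem_map] at hb
    rcases hb with ⟨c, hc, rfl⟩ | ⟨c, hc, rfl⟩ <;>
    · have := ih c hc
      by_cases hj : j = i
      · subst hj; simp [Block.inHalf, this]
      · have hj' : ¬ i = j := fun h => hj h.symm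
        simp [Block.inHalf, Function.update_of_ne hj, this, hj']

theorem DTree.exists_uniform (k : ℕ) :
    ∃ t : DTree n, ∀ b ∈ t.leaves, ∀ i, (b i).length = k := by
  refine ⟨DTree.uniform (List.replicate k (List.finRange n)).flatten, fun b hb i => ?_⟩
  rw [DTree.length_of_mem_uniform _ b hb, List.count_flatten]
  simp [List.count_eq_one_of_mem (List.nodup_finRange n) (List.mem_finRange i)]

theorem DTree.exists_leaf_embed (t : DTree n) (p : Cube n) :
    ∃ c ∈ t.leaves, ∃ s, p = c.embed s := by
  obtain ⟨c, hc, w, hw⟩ := t.exists_leaf_prefix (fun i => (p i).take t.carets) (by simp)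
  refine ⟨c, hc, w.embed (fun i => (p i).drop t.carets), ?_⟩
  rw [← Block.embed_append, ← hw]
  funext i
  simp [Block.embed, Stream'.append_take_drop]

theorem DTree.exists_bound {f : Cube n → Cube n} {t : DTree n}
    (h : ∀ b ∈ t.leaves, ∃ c, MapsBlock f b c) :
    ∃ K : ℕ, ∀ b ∈ t.leaves, ∃ c, MapsBlock f b c ∧ ∀ i, (c i).length ≤ K := by
  choose! c hc using h
  refine ⟨(t.leaves.map fun b => ∑ i, (c b i).length).sum, fun b hb => ⟨c b, hc b hb, fun i => ?_⟩⟩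
  refine le_trans ?_ (List.single_le_sum (by simp) _ (List.mem_map_of_mem hb))
  exact Finset.single_le_sum (f := fun i => (c b i).length) (by simp) (Finset.mem_univ i)

theorem Block.prefix_of_embed_eq {b c : Block n} {s s' : Cube n}
    (h : b.embed s = c.embed s') (hl : ∀ i, (c i).length ≤ (b i).length) :
    ∃ w : Block n, b = fun i => c i ++ w i := by
  refine ⟨fun i => (b i).drop (c i).length, ?_⟩
  funext i
  have hi : b i ++ₛ s i = c i ++ₛ s' i := congrFun h i
  have h1 : (b i).take (c i).length = c i := by
    rw [← Stream'.take_append_of_le_length _ _ (s i) (hl i), hi,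
      Stream'.take_append_of_le_length _ _ (s' i) le_rfl, List.take_length]
  conv_lhs => rw [← List.take_append_drop (c i).length (b i), h1]

end Group

/-- The higher dimensional Thompson group `nV`: the bijections `f` of the cube for which there is a
dyadic subdivision of the cube such that `f` maps each block of it affinely onto some basic dyadic
block. -/
def nV (n : ℕ) : Subgroup (Equiv.Perm (Cube n)) where
  carrier := {f | ∃ t : DTree n, ∀ b ∈ t.leaves, ∃ c : Block n, MapsBlock f b c}
  one_mem' := ⟨.leaf, fun b _ => ⟨b, fun _ => rfl⟩⟩
  mul_mem' := by
    rintro f g ⟨t, ht⟩ ⟨u, hu⟩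
    obtain ⟨v, hv⟩ := DTree.exists_uniform (n := n) (u.carets + t.carets)
    refine ⟨v, fun b hb => ?_⟩
    have hlen := hv b hb
    obtain ⟨d, hd, w, hw⟩ := u.exists_leaf_prefix (fun i => (b i).take u.carets)
      (fun i => by simp [hlen])
    obtain ⟨e, he⟩ := hu d hd
    have hg : MapsBlock g b (fun i => (e i ++ w i) ++ (b i).drop u.carets) := by
      have := (he.append w).append (fun i => (b i).drop u.carets)
      have hb' : (fun i => (d i ++ w i) ++ (b i).drop u.carets) = b := by
        funext i
        rw [← congrFun hw i, List.take_append_drop]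
      rwa [hb'] at this
    obtain ⟨d', hd', w', hw'⟩ := t.exists_leaf_prefix
      (fun i => (e i ++ w i) ++ (b i).drop u.carets) (fun i => by simp [hlen]; omega)
    obtain ⟨e', he'⟩ := ht d' hd'
    have hf := he'.append w'
    rw [← hw'] at hf
    exact ⟨_, fun s => by rw [Equiv.Perm.mul_apply, hg s, hf s]⟩
  inv_mem' := by
    rintro f ⟨t, ht⟩
    obtain ⟨K, hK⟩ := DTree.exists_bound ht
    obtain ⟨v, hv⟩ := DTree.exists_uniform (n := n) K
    refine ⟨v, fun b hb => ?_⟩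
    have hlen := hv b hb
    let z : Cube n := fun _ => Stream'.const false
    obtain ⟨d, hd, s, hs⟩ := t.exists_leaf_embed (f⁻¹ (b.embed z))
    obtain ⟨c, hc, hcK⟩ := hK d hd
    have h1 : b.embed z = c.embed s := by
      rw [← hc s, ← hs]; simp
    obtain ⟨w, hw⟩ := Block.prefix_of_embed_eq h1 (fun i => by rw [hlen]; exact hcK i)
    refine ⟨fun i => d i ++ w i, fun x => ?_⟩
    rw [Equiv.Perm.inv_eq_iff_eq, hc.append w x, ← hw]

/-! ### Tree-pair diagrams and grid diagrams -/

/-- A tree-pair diagram: two subdivisions of the cube, and a bijection between their blocks (both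
lists of leaves are numbered from left to right). -/
structure TreePair (n : ℕ) where
  source : DTree n
  target : DTree n
  perm : Fin source.leaves.length ≃ Fin target.leaves.length

/-- The diagram represents `f`: each block of the source subdivision is mapped affinely onto the
corresponding block of the target subdivision. -/
def TreePair.Represents {n : ℕ} (D : TreePair n) (f : Cube n → Cube n) : Prop :=
  ∀ j, MapsBlock f (D.source.leaves.get j) (D.target.leaves.get (D.perm j))

/-- A binary tree with one type of carets: a dyadic subdivision of the unit interval. -/
inductive BTree : Type
  | leaf : BTree
  | caret (l r : BTree) : BTree

/-- The tree `T`, drawn with carets of type `i`, with a copy of `t` hanging from each leaf. -/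
def BTree.hang {n : ℕ} (i : Fin n) (t : DTree n) : BTree → DTree n
  | .leaf => t
  | .caret l r => .caret i (l.hang i t) (r.hang i t)

/-- The tree of the grid subdivision that is the product of the subdivisions `T 0, …, T (n-1)` of
the coordinates: `T 0` at the root, a copy of `T 1` hanging from each of its leaves, and so on. -/
def gridTree {n : ℕ} (T : Fin n → BTree) : DTree n :=
  (List.finRange n).foldr (fun i t => (T i).hang i t) .leaf

/-- A grid (tree-pair) diagram: a tree-pair diagram whose source is a grid subdivision. -/
structure GridDiagram (n : ℕ) where
  coords : Fin n → BTree
  target : DTree n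
  perm : Fin (gridTree coords).leaves.length ≃ Fin target.leaves.length

/-- The underlying tree-pair diagram. -/
def GridDiagram.toTreePair {n : ℕ} (D : GridDiagram n) : TreePair n :=
  ⟨gridTree D.coords, D.target, D.perm⟩

/-- The number of carets of a grid diagram (of its source tree; the target tree has as many leaves,
hence as many carets). -/
def GridDiagram.carets {n : ℕ} (D : GridDiagram n) : ℕ := D.toTreePair.source.carets

/-- `t.Erase t'`: the tree `t'` arises from `t` by erasing one exposed caret. -/
inductive BTree.Erase : BTree → BTree → Prop
  | exposed : BTree.Erase (.caret .leaf .leaf) .leaf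
  | left {l l' : BTree} (r : BTree) (h : BTree.Erase l l') :
      BTree.Erase (.caret l r) (.caret l' r)
  | right (l : BTree) {r r' : BTree} (h : BTree.Erase r r') :
      BTree.Erase (.caret l r) (.caret l r')

/-- `D` is a reduced grid diagram of `f`: it represents `f`, and no exposed caret of any of its
coordinate trees can be erased, that is, after erasing one the map `f` is no longer represented by
a grid diagram with these coordinate trees. (The caret with leaves `I₁, I₂` of the `i`-th tree can be
erased iff `f` maps each of the blocks obtained by joining the two neighbours over `I₁` and `I₂`
affinely onto a basic dyadic block, and the images form a dyadic subdivision given by a tree; in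
dimension at most 2 the latter is automatic.) -/
def GridDiagram.IsReducedFor {n : ℕ} (D : GridDiagram n) (f : Cube n → Cube n) : Prop :=
  D.toTreePair.Represents f ∧
    ∀ (i : Fin n) (t' : BTree), (D.coords i).Erase t' →
      ¬ ∃ D' : GridDiagram n,
          D'.coords = Function.update D.coords i t' ∧ D'.toTreePair.Represents f

/-! ### Word length -/

/-- The word length of `x` with respect to `S`: the least length of a word in the elements of `S`
and their inverses whose product is `x`. -/
noncomputable def wordLength {G : Type*} [Group G] (S : Set G) (x : G) : ℕ :=
  sInf {k | ∃ w : List G, (∀ g ∈ w, g ∈ S ∨ g⁻¹ ∈ S) ∧ w.prod = x ∧ w.length = k}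

/-! ### Brin's generators of `2V`

Carets of type `0` are the triangular ones (vertical cuts), carets of type `1` the square ones
(horizontal cuts). -/

/-- The all-right tree with `k` carets, all triangular. -/
def allRight : ℕ → DTree 2
  | 0 => .leaf
  | k + 1 => .caret 0 .leaf (allRight k)

/-- The all-right tree with `i + 1` carets, all triangular, and a further caret of type `d` at the
leaf number `i` (counted from `0`). -/
def allRightWith (d : Fin 2) : ℕ → DTree 2
  | 0 => .caret 0 (.caret d .leaf .leaf) .leaf
  | i + 1 => .caret 0 .leaf (allRightWith d i)

theorem length_allRight (k : ℕ) : (allRight k).leaves.length = k + 1 := by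
  induction k with
  | zero => simp [allRight, DTree.leaves]
  | succ k ih => simp [allRight, DTree.leaves, ih]

theorem length_allRightWith (d : Fin 2) (i : ℕ) :
    (allRightWith d i).leaves.length = i + 3 := by
  induction i with
  | zero => simp [allRightWith, DTree.leaves]
  | succ k ih => simp [allRightWith, DTree.leaves, ih]

/-- The diagrams of `A_i` (`d = 0`) and `B_i` (`d = 1`): the `j`-th leaf of the source tree goes to
the `j`-th leaf of the all-right tree. -/
def splitDiagram (d : Fin 2) (i : ℕ) : TreePair 2 :=
  ⟨allRightWith d i, allRight (i + 2),
    finCongr ((length_allRightWith d i).trans (length_allRight (i + 2)).symm)⟩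

/-- The diagram that interchanges the leaves `i` and `i + 1` of the all-right tree with `k` carets
(leaves `0, …, k`) and fixes the other leaves. -/
def swapDiagram (k i : ℕ) (h : i < k) : TreePair 2 :=
  ⟨allRight k, allRight k,
    Equiv.swap ⟨i, by rw [length_allRight]; omega⟩ ⟨i + 1, by rw [length_allRight]; omega⟩⟩

/-- The diagrams of Brin's generators `A_i, B_i, Π_i, Π̄_i` of `2V`, for `i = 0, 1`. -/
def brinDiagrams : List (TreePair 2) :=
  [splitDiagram 0 0, splitDiagram 0 1, splitDiagram 1 0, splitDiagram 1 1,
    swapDiagram 2 0 (by norm_num), swapDiagram 3 1 (by norm_num),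
    swapDiagram 1 0 (by norm_num), swapDiagram 2 1 (by norm_num)]

/-- Brin's finite generating set `{A_0, A_1, B_0, B_1, Π_0, Π_1, Π̄_0, Π̄_1}` of `2V`. -/
def brinGenerators : Set (nV 2) :=
  {g | ∃ D ∈ brinDiagrams, D.Represents (g : Equiv.Perm (Cube 2))}

end HigherThompson

open HigherThompson

/-! The upper bound on word length is a sorting algorithm. A diagram of `x` with `M` carets is a
relabelling of one tree by another, and a group element is followed by its action on labelled trees.
In `nV` there is a finite set `moves` of elements that treat a cube divided into combs of subtrees
as stacks: they split the top of a stack and carry tops between stacks. Since a move depends only on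
the pattern near the root and on which parts are void (`Reach.move`), it acts on subtrees of any
size. Flattening the source tree to a comb costs O(M) moves (`reach_flatten`). Permuting the comb
into target order by radix sort on three stacks costs O(M) for each of the O(log M) binary digits
(`reach_perm`), and the target tree is then rebuilt by an inverse flattening. The same words show
that `moves` generates `nV`; changing to another generating set costs a constant factor.

The bound on `M` rests on `BlockBound x K`: blocks with all words of length at least `K` go to
blocks, with growth at most `K`. Such bounds add under composition, so `K` is at most linear in word
length. A reduced grid diagram of `x` has coordinate trees of depth at most `3 * K + 1`, hence at
most `2 ^ (n * (3 * K + 1))` blocks. The point is `BlockBound.exists_tree_erase`: a caret deeper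
than this can always be erased. Affineness on the joined blocks is not enough, since for `n ≥ 3`
their images need not form a tree subdivision. The target is therefore rebuilt: it is cut where its
depth in the erased direction reaches `2 * K`, each remaining piece is replaced by its slice along a
face (by `BlockBound.exists_enlarge`, `x` is still affine over the columns so obtained), and the
columns are subdivided again according to the new coordinate tree.

That Brin's elements generate `2V` follows by connecting every labelled tree to the comb of its
labels (`conn₁_comb_labels`) and permuting combs by adjacent swaps. The one change of tree not given
directly by a generator, turning a lone horizontal caret into a vertical one, is obtained after
halving both blocks (`conn₁_turn`). -/

namespace HigherThompson

/-! ### Concatenation of blocks, and leaves of trees as a tiling of the cube -/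

section Tiling

variable {n : ℕ}

/-- The block that corresponds to `w` when the cube is identified affinely with the block `b`. -/
def Block.cat (b w : Block n) : Block n := fun i => b i ++ w i

/-- The whole cube. -/
def Block.root : Block n := fun _ => []

@[simp] theorem Block.cat_apply (b w : Block n) (i : Fin n) : b.cat w i = b i ++ w i := rfl

@[simp] theorem Block.root_apply (i : Fin n) : (Block.root : Block n) i = [] := rfl

@[simp] theorem Block.cat_root (b : Block n) : b.cat Block.root = b := by
  funext i; simp

@[simp] theorem Block.root_cat (b : Block n) : Block.root.cat b = b := rfl

theorem Block.cat_assoc (a b c : Block n) : (a.cat b).cat c = a.cat (b.cat c) := by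
  funext i; simp

theorem Block.inHalf_self (i : Fin n) (a : Bool) (b : Block n) :
    b.inHalf i a i = a :: b i := by
  simp [Block.inHalf]

theorem Block.inHalf_of_ne {i j : Fin n} (h : j ≠ i) (a : Bool) (b : Block n) :
    b.inHalf i a j = b j := by
  simp [Block.inHalf, h]

theorem Block.inHalf_cat (i : Fin n) (a : Bool) (b w : Block n) :
    (b.inHalf i a).cat w = (b.cat w).inHalf i a := by
  funext j
  by_cases h : j = i
  · subst h; simp [Block.inHalf]
  · simp [Block.inHalf, h]

theorem Block.inHalf_eq_cat (i : Fin n) (a : Bool) (b : Block n) :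
    b.inHalf i a = (Block.root.inHalf i a).cat b := by
  rw [Block.inHalf_cat, Block.root_cat]

theorem Block.inHalf_injective (i : Fin n) (a : Bool) :
    Function.Injective (Block.inHalf i a : Block n → Block n) := by
  intro b c h
  funext j
  have hj := congrFun h j
  by_cases e : j = i
  · subst e; simpa [Block.inHalf] using hj
  · simpa [Block.inHalf, e] using hj

theorem Block.embed_cat (b w : Block n) (s : Cube n) :
    (b.cat w).embed s = b.embed (w.embed s) := Block.embed_append b w s

theorem Block.embed_injective (b : Block n) : Function.Injective b.embed := by
  intro s s' h
  funext i
  exact (Stream'.append_right_inj _ _ _).1 (congrFun h i)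

theorem MapsBlock.cat {f : Cube n → Cube n} {b c : Block n} (h : MapsBlock f b c)
    (w : Block n) : MapsBlock f (b.cat w) (c.cat w) := h.append w

theorem Block.eq_of_forall_embed_eq {b c : Block n} (h : ∀ s, b.embed s = c.embed s) :
    b = c := by
  have key : ∀ u v : List Bool, (∀ s : Stream' Bool, u ++ₛ s = v ++ₛ s) → u = v := by
    intro u
    induction u with
    | nil =>
      intro v hv
      cases v with
      | nil => rfl
      | cons a v =>
        have := congrArg Stream'.head (hv (Stream'.const !a))
        simp [Stream'.cons_append_stream] at this
    | cons a u ih =>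
      intro v hv
      cases v with
      | nil =>
        have := congrArg Stream'.head (hv (Stream'.const !a))
        simp [Stream'.cons_append_stream] at this
      | cons a' v =>
        have h1 := congrArg Stream'.head (hv (Stream'.const true))
        simp only [Stream'.cons_append_stream, Stream'.head_cons] at h1
        subst h1
        congr 1
        refine ih v fun s => ?_
        have := congrArg Stream'.tail (hv s)
        simpa [Stream'.cons_append_stream] using this
  funext i
  refine key _ _ fun s => ?_
  exact congrFun (h fun _ => s) i

theorem MapsBlock.target_unique {f : Cube n → Cube n} {b c c' : Block n}
    (h : MapsBlock f b c) (h' : MapsBlock f b c') : c = c' :=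
  Block.eq_of_forall_embed_eq fun s => by rw [← h s, ← h' s]

theorem MapsBlock.symm {f : Equiv.Perm (Cube n)} {b c : Block n}
    (h : MapsBlock f b c) : MapsBlock (f⁻¹ : Equiv.Perm (Cube n)) c b := by
  intro s
  rw [← h s]; simp

theorem MapsBlock.trans {f g : Equiv.Perm (Cube n)} {b c d : Block n}
    (h : MapsBlock f b c) (h' : MapsBlock g c d) :
    MapsBlock (g * f : Equiv.Perm (Cube n)) b d := by
  intro s
  rw [Equiv.Perm.mul_apply, h s, h' s]

theorem DTree.leaves_ne_nil (t : DTree n) : t.leaves ≠ [] := by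
  induction t with
  | leaf => simp [DTree.leaves]
  | caret i l r ihl ihr => simp [DTree.leaves, ihl]

theorem DTree.length_leaves (t : DTree n) : t.leaves.length = t.carets + 1 := by
  induction t with
  | leaf => simp [DTree.leaves, DTree.carets]
  | caret i l r ihl ihr => simp [DTree.leaves, DTree.carets, ihl, ihr]; omega

theorem DTree.eq_of_embed_eq (t : DTree n) : ∀ {b c : Block n}, b ∈ t.leaves → c ∈ t.leaves →
    ∀ {s s' : Cube n}, b.embed s = c.embed s' → b = c := by
  induction t with
  | leaf =>
    intro b c hb hc _ _ _
    simp only [DTree.leaves, List.mem_singleton] at hb hc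
    rw [hb, hc]
  | caret i l r ihl ihr =>
    have same : ∀ (a : Bool) (b c : Block n) (s s' : Cube n),
        (b.inHalf i a).embed s = (c.inHalf i a).embed s' → b.embed s = c.embed s' := by
      intro a b c s s' h
      rw [Block.inHalf_eq_cat, Block.inHalf_eq_cat i a c, Block.embed_cat, Block.embed_cat] at h
      exact Block.embed_injective _ h
    have diff : ∀ (b c : Block n) (s s' : Cube n),
        (b.inHalf i false).embed s ≠ (c.inHalf i true).embed s' := by
      intro b c s s' h
      have := congrArg Stream'.head (congrFun h i)
      simp [Block.embed, Block.inHalf, Stream'.cons_append_stream] at this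
    intro b c hb hc s s' h
    simp only [DTree.leaves, List.mem_append, List.mem_map] at hb hc
    rcases hb with ⟨b, hb, rfl⟩ | ⟨b, hb, rfl⟩ <;> rcases hc with ⟨c, hc, rfl⟩ | ⟨c, hc, rfl⟩
    · rw [ihl hb hc (same _ _ _ _ _ h)]
    · exact (diff _ _ _ _ h).elim
    · exact (diff _ _ _ _ h.symm).elim
    · rw [ihr hb hc (same _ _ _ _ _ h)]

theorem DTree.nodup_leaves (t : DTree n) : t.leaves.Nodup := by
  induction t with
  | leaf => simp [DTree.leaves]
  | caret i l r ihl ihr =>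
    simp only [DTree.leaves]
    refine List.Nodup.append (ihl.map (Block.inHalf_injective _ _))
      (ihr.map (Block.inHalf_injective _ _)) ?_
    intro b hb hc
    simp only [List.mem_map] at hb hc
    obtain ⟨b, -, rfl⟩ := hb
    obtain ⟨c, -, hc⟩ := hc
    have := congrFun hc i
    simp [Block.inHalf] at this

end Tiling

/-! ### Labelled trees -/

section Labelled

variable {n : ℕ} {α κ : Type*}

/-- A labelled list of blocks in which the lists `L` and `R` are put into the two halves in
direction `i`; if one of them is empty, the other one keeps the whole cube. -/
def joinLeaves (i : Fin n) : List (Block n × α) → List (Block n × α) → List (Block n × α)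
  | [], R => R
  | p :: L, [] => p :: L
  | p :: L, q :: R =>
      (p :: L).map (Prod.map (Block.inHalf i false) id) ++
        (q :: R).map (Prod.map (Block.inHalf i true) id)

/-- A tree with `n` types of carets, with labelled leaves, some of which may be void. A caret with a
void child is ignored when the subdivision is formed. -/
inductive LTree (n : ℕ) (α : Type*) : Type _
  | nil : LTree n α
  | leaf (a : α) : LTree n α
  | node (i : Fin n) (l r : LTree n α) : LTree n α

/-- The blocks of the subdivision given by a labelled tree, with their labels. -/
def LTree.leaves : LTree n α → List (Block n × α)
  | .nil => []
  | .leaf a => [(Block.root, a)]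
  | .node i l r => joinLeaves i l.leaves r.leaves

/-- Substitution of trees for the leaves. -/
def LTree.bind (f : α → LTree n κ) : LTree n α → LTree n κ
  | .nil => .nil
  | .leaf a => f a
  | .node i l r => .node i (l.bind f) (r.bind f)

/-- The labels of the leaves from left to right. -/
def LTree.labels : LTree n α → List α
  | .nil => []
  | .leaf a => [a]
  | .node _ l r => l.labels ++ r.labels

@[simp] theorem joinLeaves_nil_left (i : Fin n) (R : List (Block n × α)) :
    joinLeaves i [] R = R := rfl

@[simp] theorem joinLeaves_nil_right (i : Fin n) (L : List (Block n × α)) :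
    joinLeaves i L [] = L := by
  cases L <;> rfl

theorem joinLeaves_of_ne_nil (i : Fin n) {L R : List (Block n × α)} (hL : L ≠ [])
    (hR : R ≠ []) : joinLeaves i L R =
      L.map (Prod.map (Block.inHalf i false) id) ++
        R.map (Prod.map (Block.inHalf i true) id) := by
  cases L with
  | nil => exact (hL rfl).elim
  | cons p L =>
    cases R with
    | nil => exact (hR rfl).elim
    | cons q R => rfl

theorem LTree.map_snd_leaves (T : LTree n α) : T.leaves.map Prod.snd = T.labels := by
  induction T with
  | nil => rfl
  | leaf a => rfl
  | node i l r ihl ihr =>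
    rw [LTree.leaves, LTree.labels, ← ihl, ← ihr]
    rcases l.leaves with _ | ⟨p, L⟩ <;> rcases r.leaves with _ | ⟨q, R⟩ <;>
      simp [joinLeaves, Function.comp_def]

theorem LTree.leaves_eq_nil {T : LTree n α} : T.leaves = [] ↔ T.labels = [] := by
  rw [← T.map_snd_leaves]; simp

theorem LTree.exists_dtree (T : LTree n α) (h : T.leaves ≠ []) :
    ∃ t : DTree n, t.leaves = T.leaves.map Prod.fst := by
  induction T with
  | nil => exact (h rfl).elim
  | leaf a => exact ⟨.leaf, rfl⟩
  | node i l r ihl ihr =>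
    rw [LTree.leaves] at h ⊢
    by_cases hl : l.leaves = []
    · rw [hl] at h ⊢
      exact ihr h
    by_cases hr : r.leaves = []
    · rw [hr] at h ⊢
      simp only [joinLeaves_nil_right] at h ⊢
      exact ihl h
    obtain ⟨t, ht⟩ := ihl hl
    obtain ⟨u, hu⟩ := ihr hr
    refine ⟨.caret i t u, ?_⟩
    rw [joinLeaves_of_ne_nil i hl hr, DTree.leaves, ht, hu]
    simp [Function.comp_def]

/-- The tree `t` with labels given by a function of the blocks. -/
def LTree.ofDTree (f : Block n → α) : DTree n → LTree n α
  | .leaf => .leaf (f Block.root)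
  | .caret i l r => .node i (LTree.ofDTree (fun b => f (b.inHalf i false)) l)
      (LTree.ofDTree (fun b => f (b.inHalf i true)) r)

theorem LTree.leaves_ofDTree (t : DTree n) (f : Block n → α) :
    (LTree.ofDTree f t).leaves = t.leaves.map fun b => (b, f b) := by
  induction t generalizing f with
  | leaf => rfl
  | caret i l r ihl ihr =>
    rw [LTree.ofDTree, LTree.leaves, ihl, ihr, joinLeaves_of_ne_nil, DTree.leaves]
    · simp [Function.comp_def]
    · simpa using l.leaves_ne_nil
    · simpa using r.leaves_ne_nil

/-- Insertion of labelled lists of blocks into the blocks of a labelled list. -/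
def substLeaves (F : κ → List (Block n × α)) (E : List (Block n × κ)) : List (Block n × α) :=
  E.flatMap fun p => (F p.2).map fun q => (p.1.cat q.1, q.2)

theorem substLeaves_joinLeaves (F : κ → List (Block n × α)) (i : Fin n)
    (L R : List (Block n × κ)) (hL : ∀ p ∈ L, F p.2 ≠ []) (hR : ∀ p ∈ R, F p.2 ≠ []) :
    substLeaves F (joinLeaves i L R) = joinLeaves i (substLeaves F L) (substLeaves F R) := by
  rcases eq_or_ne L [] with rfl | hL0
  · simp [substLeaves]
  rcases eq_or_ne R [] with rfl | hR0
  · simp [substLeaves]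
  have ne : ∀ M : List (Block n × κ), (∀ p ∈ M, F p.2 ≠ []) → M ≠ [] → substLeaves F M ≠ [] := by
    intro M hM hM0
    obtain ⟨p, M, rfl⟩ := List.exists_cons_of_ne_nil hM0
    have := hM p (by simp)
    simp [substLeaves, this]
  rw [joinLeaves_of_ne_nil i hL0 hR0, joinLeaves_of_ne_nil i (ne L hL hL0) (ne R hR hR0)]
  simp [substLeaves, List.flatMap_map, List.map_flatMap, Function.comp_def, Block.inHalf_cat]

/-- The substitution that keeps the label `j` if `m j` holds, and makes it void otherwise. -/
def maskLeaf (m : κ → Bool) (j : κ) : LTree n κ := if m j then .leaf j else .nil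

/-- The substituted trees influence the upper part of the subdivision only through being void or
not. Hence a finite pattern with a mask determines how arbitrary subtrees are moved. -/
theorem LTree.leaves_bind (f : κ → LTree n α) (e : LTree n κ) :
    (e.bind f).leaves = substLeaves (fun j => (f j).leaves)
      (e.bind (maskLeaf fun j => !(f j).leaves.isEmpty)).leaves := by
  have ne : ∀ e : LTree n κ, ∀ p ∈ (e.bind (maskLeaf fun j => !(f j).leaves.isEmpty) :
      LTree n κ).leaves, (f p.2).leaves ≠ [] := by
    intro e p hp
    have hp2 : p.2 ∈ (e.bind (maskLeaf fun j => !(f j).leaves.isEmpty) : LTree n κ).labels := by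
      rw [← LTree.map_snd_leaves]; exact List.mem_map_of_mem hp
    clear hp
    induction e with
    | nil => simp [LTree.bind, LTree.labels] at hp2
    | leaf a =>
      simp only [LTree.bind, maskLeaf] at hp2
      split_ifs at hp2 with h
      · simp only [LTree.labels, List.mem_singleton] at hp2
        rw [hp2]; simpa using h
      · simp [LTree.labels] at hp2
    | node i l r ihl ihr =>
      simp only [LTree.bind, LTree.labels, List.mem_append] at hp2
      exact hp2.elim ihl ihr
  induction e with
  | nil => rfl
  | leaf a =>
    simp only [LTree.bind, maskLeaf]
    split_ifs with h
    · simp [LTree.leaves, substLeaves]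
    · simpa [LTree.leaves, substLeaves] using h
  | node i l r ihl ihr =>
    simp only [LTree.bind, LTree.leaves]
    rw [substLeaves_joinLeaves _ _ _ _ (ne l) (ne r), ihl, ihr]

/-! ### Maps that carry one labelled list of blocks to another -/

/-- `x` maps each block of the first list affinely onto a block of the second list with the same
label, and all blocks of the second list arise in this way. -/
def Carries (x : Equiv.Perm (Cube n)) (L L' : List (Block n × α)) : Prop :=
  (∀ p ∈ L, ∃ q ∈ L', q.2 = p.2 ∧ MapsBlock x p.1 q.1) ∧
    ∀ q ∈ L', ∃ p ∈ L, q.2 = p.2 ∧ MapsBlock x p.1 q.1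

theorem Carries.of_mem_iff {L L' : List (Block n × α)} (h : ∀ p, p ∈ L ↔ p ∈ L') :
    Carries 1 L L' :=
  ⟨fun p hp => ⟨p, (h p).1 hp, rfl, fun _ => rfl⟩, fun p hp => ⟨p, (h p).2 hp, rfl, fun _ => rfl⟩⟩

theorem Carries.refl (L : List (Block n × α)) : Carries 1 L L := .of_mem_iff fun _ => Iff.rfl

theorem Carries.trans {x y : Equiv.Perm (Cube n)} {L L' L'' : List (Block n × α)}
    (h : Carries x L L') (h' : Carries y L' L'') : Carries (y * x) L L'' := by
  constructor
  · intro p hp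
    obtain ⟨q, hq, e, hpq⟩ := h.1 p hp
    obtain ⟨r, hr, e', hqr⟩ := h'.1 q hq
    exact ⟨r, hr, e'.trans e, hpq.trans hqr⟩
  · intro r hr
    obtain ⟨q, hq, e, hqr⟩ := h'.2 r hr
    obtain ⟨p, hp, e', hpq⟩ := h.2 q hq
    exact ⟨p, hp, e.trans e', hpq.trans hqr⟩

theorem Carries.symm {x : Equiv.Perm (Cube n)} {L L' : List (Block n × α)}
    (h : Carries x L L') : Carries x⁻¹ L' L :=
  ⟨fun q hq => let ⟨p, hp, e, hpq⟩ := h.2 q hq; ⟨p, hp, e.symm, hpq.symm⟩,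
    fun p hp => let ⟨q, hq, e, hpq⟩ := h.1 p hp; ⟨q, hq, e.symm, hpq.symm⟩⟩

theorem Carries.subst {x : Equiv.Perm (Cube n)} {E E' : List (Block n × κ)}
    (h : Carries x E E') (F : κ → List (Block n × α)) :
    Carries x (substLeaves F E) (substLeaves F E') := by
  constructor
  · intro p hp
    simp only [substLeaves, List.mem_flatMap, List.mem_map] at hp
    obtain ⟨u, hu, w, hw, rfl⟩ := hp
    obtain ⟨v, hv, e, huv⟩ := h.1 u hu
    refine ⟨(v.1.cat w.1, w.2), ?_, rfl, huv.cat _⟩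
    simp only [substLeaves, List.mem_flatMap, List.mem_map]
    exact ⟨v, hv, w, e ▸ hw, rfl⟩
  · intro p hp
    simp only [substLeaves, List.mem_flatMap, List.mem_map] at hp
    obtain ⟨v, hv, w, hw, rfl⟩ := hp
    obtain ⟨u, hu, e, huv⟩ := h.2 v hv
    refine ⟨(u.1.cat w.1, w.2), ?_, rfl, huv.cat _⟩
    simp only [substLeaves, List.mem_flatMap, List.mem_map]
    exact ⟨u, hu, w, e ▸ hw, rfl⟩

theorem Carries.bind {x : Equiv.Perm (Cube n)} {e e' : LTree n κ} (f : κ → LTree n α)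
    (h : Carries x (e.bind (maskLeaf fun j => !(f j).leaves.isEmpty)).leaves
      (e'.bind (maskLeaf fun j => !(f j).leaves.isEmpty)).leaves) :
    Carries x (e.bind f).leaves (e'.bind f).leaves := by
  rw [LTree.leaves_bind, LTree.leaves_bind f e']
  exact h.subst _

theorem perm_eq_of_mapsBlock {x y : Equiv.Perm (Cube n)} (t : DTree n)
    (h : ∀ b ∈ t.leaves, ∃ c, MapsBlock x b c ∧ MapsBlock y b c) : x = y := by
  ext1 p
  obtain ⟨b, hb, s, rfl⟩ := t.exists_leaf_embed p
  obtain ⟨c, hx, hy⟩ := h b hb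
  rw [hx s, hy s]

/-- The blocks of a nonvoid tree cover the cube, and distinct target labels leave one possible image
for each of them. -/
theorem Carries.unique {x y : Equiv.Perm (Cube n)} {T : LTree n α} {L' : List (Block n × α)}
    (hT : T.leaves ≠ []) (hL' : (L'.map Prod.snd).Nodup)
    (hx : Carries x T.leaves L') (hy : Carries y T.leaves L') : x = y := by
  obtain ⟨t, ht⟩ := T.exists_dtree hT
  refine perm_eq_of_mapsBlock t fun b hb => ?_
  rw [ht, List.mem_map] at hb
  obtain ⟨p, hp, rfl⟩ := hb
  obtain ⟨q, hq, e, h⟩ := hx.1 p hp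
  obtain ⟨q', hq', e', h'⟩ := hy.1 p hp
  obtain rfl : q = q' := List.inj_on_of_nodup_map hL' hq hq' (e.trans e'.symm)
  exact ⟨_, h, h'⟩

theorem exists_mapsBlock {L L' : List (Block n × α)} {t : DTree n} (ht : t.leaves = L.map Prod.fst)
    (hL' : (L'.map Prod.snd).Nodup) (hsub : ∀ p ∈ L, ∃ q ∈ L', q.2 = p.2) :
    ∃ f : Cube n → Cube n, ∀ p ∈ L, ∀ q ∈ L', q.2 = p.2 → MapsBlock f p.1 q.1 := by
  have hex : ∀ x : Cube n, ∃ y : Cube n, ∀ p ∈ L, ∀ q ∈ L', q.2 = p.2 →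
      ∀ s, x = p.1.embed s → y = q.1.embed s := by
    intro x
    obtain ⟨b, hb, s, rfl⟩ := t.exists_leaf_embed x
    have hb' := hb
    rw [ht, List.mem_map] at hb'
    obtain ⟨p, hp, rfl⟩ := hb'
    obtain ⟨q, hq, e⟩ := hsub p hp
    refine ⟨q.1.embed s, fun p' hp' q' hq' e' s' hs => ?_⟩
    have h1 : p.1 = p'.1 := t.eq_of_embed_eq hb
      (by rw [ht]; exact List.mem_map_of_mem hp') hs
    have h2 : p = p' := List.inj_on_of_nodup_map (ht ▸ t.nodup_leaves) hp hp' h1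
    subst h2
    obtain rfl : q = q' := List.inj_on_of_nodup_map hL' hq hq' (e.trans e'.symm)
    rw [Block.embed_injective _ hs]
  choose f hf using hex
  exact ⟨f, fun p hp q hq e s => hf _ p hp q hq e s rfl⟩

/-- Both families of blocks tile the cube unless void, so the affine maps between blocks of equal
label glue to a map; the same construction with the trees exchanged gives its inverse. -/
theorem exists_carries {T T' : LTree n α} (h : T.labels.Nodup) (h' : T'.labels.Nodup)
    (hmem : ∀ a, a ∈ T.labels ↔ a ∈ T'.labels) :
    ∃ x : nV n, Carries (x : Equiv.Perm (Cube n)) T.leaves T'.leaves := by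
  by_cases hT : T.leaves = []
  · refine ⟨1, ?_⟩
    have hT' : T'.leaves = [] := by
      rw [LTree.leaves_eq_nil] at hT ⊢
      simpa [hT, List.eq_nil_iff_forall_not_mem] using hmem
    rw [hT, hT']
    exact .refl _
  have hT' : T'.leaves ≠ [] := by
    intro h0
    apply hT
    rw [LTree.leaves_eq_nil] at h0 ⊢
    simpa [h0, List.eq_nil_iff_forall_not_mem] using hmem
  obtain ⟨t, ht⟩ := T.exists_dtree hT
  obtain ⟨t', ht'⟩ := T'.exists_dtree hT'
  rw [← LTree.map_snd_leaves] at h h'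
  have hsub : ∀ p ∈ T.leaves, ∃ q ∈ T'.leaves, q.2 = p.2 := by
    intro p hp
    have : p.2 ∈ T'.labels := (hmem _).1 (by
      rw [← LTree.map_snd_leaves]; exact List.mem_map_of_mem hp)
    rw [← LTree.map_snd_leaves, List.mem_map] at this
    exact this
  have hsub' : ∀ p ∈ T'.leaves, ∃ q ∈ T.leaves, q.2 = p.2 := by
    intro p hp
    have : p.2 ∈ T.labels := (hmem _).2 (by
      rw [← LTree.map_snd_leaves]; exact List.mem_map_of_mem hp)
    rw [← LTree.map_snd_leaves, List.mem_map] at this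
    exact this
  obtain ⟨f, hf⟩ := exists_mapsBlock ht h' hsub
  obtain ⟨g, hg⟩ := exists_mapsBlock ht' h hsub'
  have inv : ∀ {u : DTree n} {T T' : LTree n α} {f g : Cube n → Cube n},
      u.leaves = T.leaves.map Prod.fst →
      (∀ p ∈ T.leaves, ∃ q ∈ T'.leaves, q.2 = p.2) →
      (∀ p ∈ T.leaves, ∀ q ∈ T'.leaves, q.2 = p.2 → MapsBlock f p.1 q.1) →
      (∀ p ∈ T'.leaves, ∀ q ∈ T.leaves, q.2 = p.2 → MapsBlock g p.1 q.1) →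
      Function.LeftInverse g f := by
    intro u T T' f g hu hs hf hg x
    obtain ⟨b, hb, s, rfl⟩ := u.exists_leaf_embed x
    rw [hu, List.mem_map] at hb
    obtain ⟨p, hp, rfl⟩ := hb
    obtain ⟨q, hq, e⟩ := hs p hp
    rw [hf p hp q hq e s, hg q hq p hp e.symm s]
  refine ⟨⟨⟨f, g, inv ht hsub hf hg, inv ht' hsub' hg hf⟩, t, fun b hb => ?_⟩, ?_, ?_⟩
  · rw [ht, List.mem_map] at hb
    obtain ⟨p, hp, rfl⟩ := hb
    obtain ⟨q, hq, e⟩ := hsub p hp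
    exact ⟨q.1, hf p hp q hq e⟩
  · intro p hp
    obtain ⟨q, hq, e⟩ := hsub p hp
    exact ⟨q, hq, e, hf p hp q hq e⟩
  · intro q hq
    obtain ⟨p, hp, e⟩ := hsub' q hq
    exact ⟨p, hp, e.symm, hf p hp q hq e.symm⟩

end Labelled

/-! ### Words that carry one labelled list of blocks to another -/

section Reach

variable {n : ℕ} {α : Type*}

/-- Some word of length at most `m` in the elements of `Γ` and their inverses carries the
first list to the second one. -/
def Reach (Γ : Set (nV n)) (m : ℕ) (L L' : List (Block n × α)) : Prop :=
  ∃ w : List (nV n), (∀ g ∈ w, g ∈ Γ ∨ g⁻¹ ∈ Γ) ∧ w.length ≤ m ∧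
    Carries (w.prod : Equiv.Perm (Cube n)) L L'

variable {Γ : Set (nV n)}

theorem Reach.refl (m : ℕ) (L : List (Block n × α)) : Reach Γ m L L :=
  ⟨[], by simp, by simp, by simpa using Carries.refl L⟩

theorem Reach.of_mem {g : nV n} (hg : g ∈ Γ) {L L' : List (Block n × α)}
    (h : Carries (g : Equiv.Perm (Cube n)) L L') : Reach Γ 1 L L' :=
  ⟨[g], by simp [hg], by simp, by simpa using h⟩

theorem Reach.trans {m k : ℕ} {L L' L'' : List (Block n × α)} (h : Reach Γ m L L')
    (h' : Reach Γ k L' L'') : Reach Γ (m + k) L L'' := by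
  obtain ⟨w, hw, hl, hc⟩ := h
  obtain ⟨w', hw', hl', hc'⟩ := h'
  refine ⟨w' ++ w, ?_, by simp; omega, ?_⟩
  · intro g hg
    rcases List.mem_append.1 hg with hg | hg
    exacts [hw' g hg, hw g hg]
  · rw [List.prod_append, Subgroup.coe_mul]
    exact hc.trans hc'

theorem Reach.symm {m : ℕ} {L L' : List (Block n × α)} (h : Reach Γ m L L') :
    Reach Γ m L' L := by
  obtain ⟨w, hw, hl, hc⟩ := h
  refine ⟨(w.map (·⁻¹)).reverse, ?_, by simpa using hl, ?_⟩
  · intro g hg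
    simp only [List.mem_reverse, List.mem_map] at hg
    obtain ⟨g, hg, rfl⟩ := hg
    simpa using (hw g hg).symm
  · rw [← List.prod_inv_reverse, Subgroup.coe_inv]
    exact hc.symm

theorem Reach.mono {m k : ℕ} (hmk : m ≤ k) {L L' : List (Block n × α)} (h : Reach Γ m L L') :
    Reach Γ k L L' := by
  obtain ⟨w, hw, hl, hc⟩ := h
  exact ⟨w, hw, hl.trans hmk, hc⟩

end Reach

/-! ### Diagrams as labelled trees -/

section Diagrams

variable {n : ℕ} {α : Type*}

theorem LTree.labels_ofDTree (t : DTree n) (f : Block n → α) :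
    (LTree.ofDTree f t).labels = t.leaves.map f := by
  rw [← LTree.map_snd_leaves, LTree.leaves_ofDTree]; simp [Function.comp_def]

/-- The source tree of a diagram of `x`, labelled by the images of its blocks, is carried to the
target tree. -/
theorem TreePair.Represents.exists_carries {x : Equiv.Perm (Cube n)} {D : TreePair n}
    (hD : D.Represents x) :
    ∃ f : Block n → Block n, (D.source.leaves.map f).Perm D.target.leaves ∧
      Carries x (LTree.ofDTree f D.source).leaves (LTree.ofDTree id D.target).leaves := by
  have him : ∀ c ∈ D.source.leaves, ∃ d, MapsBlock x c d := by
    intro c hc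
    obtain ⟨j, rfl⟩ := List.get_of_mem hc
    exact ⟨_, hD j⟩
  choose! f hf using him
  have hfj : ∀ j, f (D.source.leaves.get j) = D.target.leaves.get (D.perm j) := fun j =>
    (hf _ (List.get_mem _ _)).target_unique (hD j)
  have hperm : (D.source.leaves.map f).Perm D.target.leaves := by
    have hnd : (D.source.leaves.map f).Nodup := by
      rw [List.nodup_map_iff_inj_on D.source.nodup_leaves]
      intro c hc d hd hcd
      exact (hf c hc).symm.target_unique (hcd ▸ (hf d hd).symm)
    rw [List.perm_ext_iff_of_nodup hnd D.target.nodup_leaves]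
    intro d
    constructor
    · intro hd
      obtain ⟨c, hc, rfl⟩ := List.mem_map.1 hd
      obtain ⟨j, rfl⟩ := List.get_of_mem hc
      rw [hfj]
      exact List.get_mem _ _
    · intro hd
      obtain ⟨k, rfl⟩ := List.get_of_mem hd
      refine List.mem_map.2 ⟨D.source.leaves.get (D.perm.symm k), List.get_mem _ _, ?_⟩
      rw [hfj, Equiv.apply_symm_apply]
  refine ⟨f, hperm, ?_⟩
  rw [LTree.leaves_ofDTree, LTree.leaves_ofDTree]
  constructor
  · intro p hp
    obtain ⟨c, hc, rfl⟩ := List.mem_map.1 hp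
    exact ⟨(f c, f c), List.mem_map.2 ⟨f c, hperm.subset (List.mem_map_of_mem hc), rfl⟩, rfl,
      hf c hc⟩
  · intro q hq
    obtain ⟨d, hd, rfl⟩ := List.mem_map.1 hq
    obtain ⟨c, hc, rfl⟩ := List.mem_map.1 (hperm.symm.subset hd)
    exact ⟨(c, f c), List.mem_map.2 ⟨c, hc, rfl⟩, rfl, hf c hc⟩

theorem Carries.unique_ofDTree {x y : Equiv.Perm (Cube n)} {s t : DTree n} {f : Block n → Block n}
    (hx : Carries x (LTree.ofDTree f s).leaves (LTree.ofDTree id t).leaves)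
    (hy : Carries y (LTree.ofDTree f s).leaves (LTree.ofDTree id t).leaves) : x = y := by
  refine Carries.unique ?_ ?_ hx hy
  · simpa [LTree.leaves_ofDTree] using s.leaves_ne_nil
  · rw [LTree.map_snd_leaves, LTree.labels_ofDTree, List.map_id]
    exact t.nodup_leaves

theorem TreePair.carets_target (D : TreePair n) : D.target.carets = D.source.carets := by
  have := Fin.equiv_iff_eq.1 ⟨D.perm⟩
  rw [DTree.length_leaves, DTree.length_leaves] at this
  omega

end Diagrams

/-! ### A finite set of moves -/

section Moves

theorem LTree.labels_bind_maskLeaf {n : ℕ} {κ : Type*} (m : κ → Bool) (e : LTree n κ) :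
    (e.bind (maskLeaf m) : LTree n κ).labels = e.labels.filter m := by
  induction e with
  | nil => rfl
  | leaf a => by_cases h : m a <;> simp [LTree.bind, maskLeaf, LTree.labels, h]
  | node i l r ihl ihr => simp [LTree.bind, LTree.labels, ihl, ihr]

variable {n : ℕ} [NeZero n] {α : Type*}

/-- Pairs of trees with the same labels. With a comb of subtrees regarded as a stack, they describe
moving the top of a stack to another stack, and splitting the top of a stack. -/
def movePatterns (n : ℕ) [NeZero n] : List (LTree n (Fin 4) × LTree n (Fin 4)) :=
  (.node 0 (.leaf 0) (.node 0 (.leaf 1) (.leaf 2)),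
    .node 0 (.node 0 (.leaf 1) (.leaf 0)) (.leaf 2)) ::
  (.node 0 (.node 0 (.leaf 0) (.leaf 1)) (.node 0 (.leaf 2) (.leaf 3)),
    .node 0 (.leaf 1) (.node 0 (.node 0 (.leaf 0) (.leaf 2)) (.leaf 3))) ::
  (.node 0 (.node 0 (.leaf 0) (.leaf 1)) (.node 0 (.leaf 2) (.leaf 3)),
    .node 0 (.leaf 1) (.node 0 (.leaf 2) (.node 0 (.leaf 0) (.leaf 3)))) ::
  (List.finRange n).map fun i =>
    (.node 0 (.leaf 0) (.node 0 (.node i (.leaf 1) (.leaf 2)) (.leaf 3)),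
      .node 0 (.leaf 0) (.node 0 (.leaf 1) (.node 0 (.leaf 2) (.leaf 3))))

/-- The elements of `nV` that perform a move; the parts of a pattern that are void are dropped. -/
def moves (n : ℕ) [NeZero n] : Set (nV n) :=
  {g | ∃ e ∈ movePatterns n, ∃ m : Fin 4 → Bool, (e.1.bind (maskLeaf m)).leaves ≠ [] ∧
    Carries (g : Equiv.Perm (Cube n)) (e.1.bind (maskLeaf m)).leaves
      (e.2.bind (maskLeaf m)).leaves}

theorem movePatterns_spec {e : LTree n (Fin 4) × LTree n (Fin 4)} (he : e ∈ movePatterns n) :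
    e.1.labels.Nodup ∧ e.2.labels.Nodup ∧ ∀ a, a ∈ e.1.labels ↔ a ∈ e.2.labels := by
  simp only [movePatterns, List.mem_cons, List.mem_map] at he
  rcases he with rfl | rfl | rfl | ⟨i, -, rfl⟩ <;> simp only [LTree.labels] <;> decide

/-- There are finitely many patterns and masks, and each pair determines at most one element because
its trees are nonvoid and have distinct labels. -/
theorem finite_moves (n : ℕ) [NeZero n] : (moves n).Finite := by
  have : moves n ⊆ ⋃ e ∈ {e | e ∈ movePatterns n}, ⋃ m : Fin 4 → Bool,
      {g | (e.1.bind (maskLeaf m)).leaves ≠ [] ∧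
        Carries (g : Equiv.Perm (Cube n)) (e.1.bind (maskLeaf m)).leaves
          (e.2.bind (maskLeaf m)).leaves} := by
    rintro g ⟨e, he, m, h⟩
    simp only [Set.mem_iUnion]
    exact ⟨e, he, m, h⟩
  refine Set.Finite.subset ?_ this
  refine (List.finite_toSet _).biUnion fun e he => Set.finite_iUnion fun m => ?_
  refine Set.Subsingleton.finite ?_
  rintro g ⟨h0, hg⟩ g' ⟨-, hg'⟩
  refine Subtype.ext (Carries.unique h0 ?_ hg hg')
  rw [LTree.map_snd_leaves, LTree.labels_bind_maskLeaf]
  exact (movePatterns_spec he).2.1.filter _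

theorem Reach.move {e : LTree n (Fin 4) × LTree n (Fin 4)} (he : e ∈ movePatterns n)
    (f : Fin 4 → LTree n α) :
    Reach (moves n) 1 (e.1.bind f).leaves (e.2.bind f).leaves := by
  set m : Fin 4 → Bool := fun j => !(f j).leaves.isEmpty with hm
  obtain ⟨h1, h2, h3⟩ := movePatterns_spec he
  obtain ⟨x, hx⟩ := exists_carries (T := e.1.bind (maskLeaf m)) (T' := e.2.bind (maskLeaf m))
    (by rw [LTree.labels_bind_maskLeaf]; exact h1.filter _)
    (by rw [LTree.labels_bind_maskLeaf]; exact h2.filter _)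
    (by intro a; simp [LTree.labels_bind_maskLeaf, h3])
  by_cases h0 : (e.1.bind (maskLeaf m)).leaves = []
  · have h0' : (e.2.bind (maskLeaf m)).leaves = [] := by
      rw [LTree.leaves_eq_nil, LTree.labels_bind_maskLeaf, List.filter_eq_nil_iff] at h0 ⊢
      exact fun a ha => h0 a ((h3 a).2 ha)
    rw [LTree.leaves_bind, LTree.leaves_bind f e.2, ← hm, h0, h0']
    exact .refl _ _
  · have hxm : x ∈ moves n := ⟨e, he, m, h0, hx⟩
    exact .of_mem hxm (hx.bind f)

/-! ### Stacks -/

/-- The comb whose leaves are labelled by the list; its last leaf is void. -/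
def comb : List α → LTree n α
  | [] => .nil
  | a :: L => .node 0 (.leaf a) (comb L)

theorem reach_push (D W : LTree n α) (a : LTree n α) :
    Reach (moves n) 1 (LTree.node 0 D (.node 0 a W)).leaves
      (LTree.node 0 (.node 0 a D) W).leaves :=
  Reach.move (e := (.node 0 (.leaf 0) (.node 0 (.leaf 1) (.leaf 2)),
    .node 0 (.node 0 (.leaf 1) (.leaf 0)) (.leaf 2))) (by simp [movePatterns]) ![D, a, W, .nil]

theorem reach_split (i : Fin n) (D l r W : LTree n α) :
    Reach (moves n) 1 (LTree.node 0 D (.node 0 (.node i l r) W)).leaves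
      (LTree.node 0 D (.node 0 l (.node 0 r W))).leaves :=
  Reach.move (e := (.node 0 (.leaf 0) (.node 0 (.node i (.leaf 1) (.leaf 2)) (.leaf 3)),
    .node 0 (.leaf 0) (.node 0 (.leaf 1) (.node 0 (.leaf 2) (.leaf 3)))))
    (by simp [movePatterns]) ![D, l, r, W]

theorem reach_second (a X Y Z : LTree n α) :
    Reach (moves n) 1 (LTree.node 0 (.node 0 a X) (.node 0 Y Z)).leaves
      (LTree.node 0 X (.node 0 (.node 0 a Y) Z)).leaves :=
  Reach.move (e := (.node 0 (.node 0 (.leaf 0) (.leaf 1)) (.node 0 (.leaf 2) (.leaf 3)),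
    .node 0 (.leaf 1) (.node 0 (.node 0 (.leaf 0) (.leaf 2)) (.leaf 3))))
    (by simp [movePatterns]) ![a, X, Y, Z]

theorem reach_third (a X Y Z : LTree n α) :
    Reach (moves n) 1 (LTree.node 0 (.node 0 a X) (.node 0 Y Z)).leaves
      (LTree.node 0 X (.node 0 Y (.node 0 a Z))).leaves :=
  Reach.move (e := (.node 0 (.node 0 (.leaf 0) (.leaf 1)) (.node 0 (.leaf 2) (.leaf 3)),
    .node 0 (.leaf 1) (.node 0 (.leaf 2) (.node 0 (.leaf 0) (.leaf 3)))))
    (by simp [movePatterns]) ![a, X, Y, Z]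

/-- The tree is traversed depth first with `W` as the stack of pending subtrees and `A` as the
output stack: one split per caret and one push per leaf. Pushing reverses the order of the labels.
-/
theorem reach_flatten_aux (t : DTree n) (f : Block n → α) (A : List α) (W : LTree n α) :
    Reach (moves n) (2 * t.carets + 1) (LTree.node 0 (comb A) (.node 0 (.ofDTree f t) W)).leaves
      (LTree.node 0 (comb ((LTree.ofDTree f t).labels.reverse ++ A)) W).leaves := by
  induction t generalizing f A W with
  | leaf => exact reach_push _ _ _
  | caret i l r ihl ihr =>
    have h := ((reach_split i (comb A) (.ofDTree (fun b => f (b.inHalf i false)) l)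
      (.ofDTree (fun b => f (b.inHalf i true)) r) W).trans (ihl _ A _)).trans (ihr _ _ W)
    have hc : 1 + (2 * l.carets + 1) + (2 * r.carets + 1) = 2 * (DTree.caret i l r).carets + 1 := by
      simp only [DTree.carets]; omega
    rw [hc] at h
    simpa [LTree.ofDTree, LTree.labels] using h

theorem reach_flatten (t : DTree n) (f : Block n → α) :
    Reach (moves n) (2 * t.carets + 1) (LTree.ofDTree f t).leaves
      (comb (n := n) (LTree.ofDTree f t).labels.reverse).leaves := by
  simpa [LTree.leaves, comb] using reach_flatten_aux t f [] .nil

/-- Three stacks. -/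
def threeStacks (A B C : List α) : List (Block n × α) :=
  (LTree.node 0 (comb A) (.node 0 (comb B) (comb C)) : LTree n α).leaves

theorem threeStacks_nil_nil (A : List α) : threeStacks (n := n) A [] [] = (comb A).leaves := by
  simp [threeStacks, LTree.leaves, comb]

theorem reach_distribute (p : α → Bool) (A B C : List α) :
    Reach (moves n) A.length (threeStacks A B C)
      (threeStacks [] ((A.filter p).reverse ++ B) ((A.filter fun a => !p a).reverse ++ C)) := by
  induction A generalizing B C with
  | nil => exact .refl _ _
  | cons a A ih =>
    rw [List.length_cons, add_comm]
    by_cases h : p a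
    · have h1 : Reach (moves n) 1 (threeStacks (a :: A) B C) (threeStacks A (a :: B) C) :=
        reach_second _ _ _ _
      simpa [h] using h1.trans (ih (a :: B) C)
    · have h1 : Reach (moves n) 1 (threeStacks (a :: A) B C) (threeStacks A B (a :: C)) :=
        reach_third _ _ _ _
      simpa [h] using h1.trans (ih B (a :: C))

theorem reach_gather_third (A B C : List α) :
    Reach (moves n) C.length (threeStacks A B C) (threeStacks (C.reverse ++ A) B []) := by
  induction C generalizing A with
  | nil => exact .refl _ _
  | cons c C ih =>
    have h1 : Reach (moves n) 1 (threeStacks A B (c :: C)) (threeStacks (c :: A) B C) :=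
      (reach_third _ _ _ _).symm
    rw [List.length_cons, add_comm]
    simpa using h1.trans (ih (c :: A))

theorem reach_gather_second (A B : List α) :
    Reach (moves n) B.length (threeStacks A B []) (threeStacks (B.reverse ++ A) [] []) := by
  induction B generalizing A with
  | nil => exact .refl _ _
  | cons b B ih =>
    have h1 : Reach (moves n) 1 (threeStacks A (b :: B) []) (threeStacks (b :: A) B []) :=
      (reach_second _ _ _ _).symm
    rw [List.length_cons, add_comm]
    simpa using h1.trans (ih (b :: A))

/-- Distribution to the other two stacks and collection from them each reverse the order, so the
partition is stable. The third stack is collected first, which leaves the elements satisfying `p` on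
top. -/
theorem reach_partition (p : α → Bool) (A : List α) :
    Reach (moves n) (2 * A.length) (threeStacks A [] [])
      (threeStacks (A.filter p ++ A.filter fun a => !p a) [] []) := by
  have h := ((reach_distribute (n := n) p A [] []).trans (reach_gather_third _ _ _)).trans
    (reach_gather_second _ _)
  have hl := List.length_eq_length_filter_add (l := A) p
  simp only [List.append_nil, List.reverse_reverse, List.length_reverse] at h
  exact h.mono (by omega)

/-! ### Radix sort -/

/-- Least significant digit first: a stable partition by the next binary digit keeps the order
already achieved among elements that agree in this digit. -/
theorem reach_radix (key : α → ℕ) (A : List α) (b : ℕ) :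
    ∃ A' : List α, A'.Perm A ∧ A'.Pairwise (fun x y => key x % 2 ^ b ≤ key y % 2 ^ b) ∧
      Reach (moves n) (2 * A.length * b) (threeStacks A [] []) (threeStacks A' [] []) := by
  induction b with
  | zero => exact ⟨A, .refl _, by simp [Nat.mod_one, List.pairwise_of_forall], .refl _ _⟩
  | succ b ih =>
    obtain ⟨A', hp, hs, hr⟩ := ih
    have bit : ∀ x, key x % 2 ^ (b + 1) = key x % 2 ^ b + 2 ^ b * (key x / 2 ^ b % 2) :=
      fun x => by rw [pow_succ, Nat.mod_mul]
    have lt : ∀ x, key x % 2 ^ b < 2 ^ b := fun x => Nat.mod_lt _ (by positivity)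
    let p : α → Bool := fun x => decide (key x / 2 ^ b % 2 = 0)
    refine ⟨A'.filter p ++ A'.filter fun a => !p a, ?_, ?_, ?_⟩
    · exact (List.filter_append_perm p A').trans hp
    · rw [List.pairwise_append]
      refine ⟨?_, ?_, ?_⟩
      · refine List.Pairwise.imp_of_mem ?_ (hs.sublist List.filter_sublist)
        intro x y hx hy hxy
        have hx := (List.mem_filter.1 hx).2
        have hy := (List.mem_filter.1 hy).2
        simp only [p, decide_eq_true_eq] at hx hy
        rw [bit, bit, hx, hy]; omega
      · refine List.Pairwise.imp_of_mem ?_ (hs.sublist List.filter_sublist)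
        intro x y hx hy hxy
        have hx := (List.mem_filter.1 hx).2
        have hy := (List.mem_filter.1 hy).2
        simp only [p, Bool.not_eq_true', decide_eq_false_iff_not, Nat.mod_two_ne_zero] at hx hy
        rw [bit, bit, hx, hy]; omega
      -- Here the new digit is 0 for `x` and 1 for `y`, which outweighs all lower digits.
      · intro x hx y hy
        have hx := (List.mem_filter.1 hx).2
        have hy := (List.mem_filter.1 hy).2
        simp only [p, Bool.not_eq_true', decide_eq_true_eq, decide_eq_false_iff_not,
          Nat.mod_two_ne_zero] at hx hy
        rw [bit, bit, hx, hy]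
        have := lt x
        omega
    · have := hr.trans (reach_partition p A')
      rw [hp.length_eq] at this
      rwa [Nat.mul_succ]

/-- The sorting key is the position in `A'`; it has at most `b` binary digits and determines the
element, so the sorted list is `A'` itself. -/
theorem reach_perm {A A' : List α} (h : A.Perm A') (hA : A'.Nodup) {b : ℕ}
    (hb : A'.length ≤ 2 ^ b) :
    Reach (moves n) (2 * A.length * b) (comb (n := n) A).leaves (comb A').leaves := by
  classical
  obtain ⟨R, hp, hs, hr⟩ := reach_radix (n := n) (fun a => A'.idxOf a) A b
  have hlt : ∀ a ∈ A', A'.idxOf a % 2 ^ b = A'.idxOf a := fun a ha =>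
    Nat.mod_eq_of_lt ((List.idxOf_lt_length_iff.2 ha).trans_le hb)
  have hRA : R.Perm A' := hp.trans h
  have hA' : A'.Pairwise fun x y => A'.idxOf x ≤ A'.idxOf y := by
    rw [List.pairwise_iff_getElem]
    intro i j hi hj hij
    rw [hA.idxOf_getElem, hA.idxOf_getElem]
    exact hij.le
  have hR : R.Pairwise fun x y => A'.idxOf x ≤ A'.idxOf y := by
    refine hs.imp_of_mem fun hx hy hxy => ?_
    rwa [hlt _ (hRA.subset hx), hlt _ (hRA.subset hy)] at hxy
  have : R = A' := by
    refine List.Perm.eq_of_pairwise ?_ hR hA' hRA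
    intro x y hx hy hxy hyx
    exact (List.idxOf_inj (hRA.subset hx)).1 (le_antisymm hxy hyx)
  rw [← threeStacks_nil_nil, ← threeStacks_nil_nil, ← this]
  exact hr

/-! ### Length of an element in terms of the size of a tree-pair diagram -/

theorem exists_word_of_represents (x : nV n) (D : TreePair n)
    (hD : D.Represents (x : Equiv.Perm (Cube n))) {b : ℕ} (hb : D.source.carets + 1 ≤ 2 ^ b) :
    ∃ w : List (nV n), (∀ g ∈ w, g ∈ moves n ∨ g⁻¹ ∈ moves n) ∧ w.prod = x ∧
      w.length ≤ (D.source.carets + 1) * (2 * b + 4) := by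
  obtain ⟨f, hperm, hcar⟩ := hD.exists_carries
  have hrev : (D.source.leaves.map f).reverse.Perm D.target.leaves.reverse :=
    (List.reverse_perm _).trans (hperm.trans (List.reverse_perm _).symm)
  have h1 := reach_flatten D.source f
  have h3 := (reach_flatten D.target id).symm
  rw [LTree.labels_ofDTree] at h1 h3
  rw [List.map_id] at h3
  have h2 := reach_perm (n := n) hrev (List.nodup_reverse.2 D.target.nodup_leaves) (b := b)
    (by rw [List.length_reverse, DTree.length_leaves, D.carets_target]; exact hb)
  obtain ⟨w, hw, hl, hc⟩ := (h1.trans h2).trans h3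
  refine ⟨w, hw, Subtype.ext (hc.unique_ofDTree hcar), hl.trans ?_⟩
  -- With `M` carets, the two flattenings cost `2 * M + 1` each and the sorting `2 * (M + 1) * b`.
  rw [List.length_reverse, List.length_map, DTree.length_leaves, D.carets_target]
  nlinarith

end Moves

/-! ### Leaves of grids -/

section Grid

variable {n : ℕ}

/-- The words of the leaves of a binary tree. -/
def BTree.words : BTree → List (List Bool)
  | .leaf => [[]]
  | .caret l r => l.words.map (false :: ·) ++ r.words.map (true :: ·)

theorem BTree.mem_leaves_hang (i : Fin n) (t : DTree n) (T : BTree) (b : Block n) :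
    b ∈ (T.hang i t).leaves ↔
      ∃ w ∈ T.words, ∃ c ∈ t.leaves, b = Function.update c i (w ++ c i) := by
  induction T generalizing b with
  | leaf => simp [BTree.hang, BTree.words]
  | caret l r ihl ihr =>
    simp only [BTree.hang, BTree.words, DTree.leaves, List.mem_append, List.mem_map, ihl, ihr]
    constructor
    · rintro (⟨_, ⟨w, hw, c, hc, rfl⟩, rfl⟩ | ⟨_, ⟨w, hw, c, hc, rfl⟩, rfl⟩)
      · exact ⟨_, Or.inl ⟨w, hw, rfl⟩, c, hc, by simp [Block.inHalf]⟩
      · exact ⟨_, Or.inr ⟨w, hw, rfl⟩, c, hc, by simp [Block.inHalf]⟩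
    · rintro ⟨_, ⟨w, hw, rfl⟩ | ⟨w, hw, rfl⟩, c, hc, rfl⟩
      · exact Or.inl ⟨_, ⟨w, hw, c, hc, rfl⟩, by simp [Block.inHalf]⟩
      · exact Or.inr ⟨_, ⟨w, hw, c, hc, rfl⟩, by simp [Block.inHalf]⟩

theorem mem_leaves_foldr_hang (T : Fin n → BTree) (L : List (Fin n)) (hL : L.Nodup)
    (b : Block n) :
    b ∈ (L.foldr (fun i t => (T i).hang i t) DTree.leaf).leaves ↔
      ∀ i, (i ∈ L → b i ∈ (T i).words) ∧ (i ∉ L → b i = []) := by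
  induction L generalizing b with
  | nil => simp [DTree.leaves, funext_iff]
  | cons j L ih =>
    rw [List.nodup_cons] at hL
    rw [List.foldr_cons, BTree.mem_leaves_hang]
    constructor
    · rintro ⟨w, hw, c, hc, rfl⟩ i
      have hc := (ih hL.2 c).1 hc
      by_cases h : i = j
      · subst h
        simpa [(hc i).2 hL.1] using hw
      · simpa [h] using hc i
    · intro h
      refine ⟨b j, (h j).1 (by simp), Function.update b j [], (ih hL.2 _).2 fun i => ?_, ?_⟩
      · by_cases e : i = j
        · subst e; simp [hL.1]
        · simpa [e] using h i
      · simp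

theorem mem_leaves_gridTree (T : Fin n → BTree) (b : Block n) :
    b ∈ (gridTree T).leaves ↔ ∀ i, b i ∈ (T i).words := by
  rw [gridTree, mem_leaves_foldr_hang T _ (List.nodup_finRange n)]
  simp

theorem BTree.length_leaves_hang (i : Fin n) (t : DTree n) (T : BTree) :
    (T.hang i t).leaves.length = T.words.length * t.leaves.length := by
  induction T with
  | leaf => simp [BTree.hang, BTree.words]
  | caret l r ihl ihr => simp [BTree.hang, BTree.words, DTree.leaves, ihl, ihr, add_mul]

theorem BTree.length_words_le (T : BTree) {d : ℕ} (h : ∀ w ∈ T.words, w.length ≤ d) :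
    T.words.length ≤ 2 ^ d := by
  induction T generalizing d with
  | leaf => simpa [BTree.words] using Nat.one_le_two_pow
  | caret l r ihl ihr =>
    have hne : ∀ T : BTree, ∃ w, w ∈ T.words := by
      intro T
      induction T with
      | leaf => exact ⟨[], by simp [BTree.words]⟩
      | caret l r ihl _ => exact ihl.elim fun w hw => ⟨false :: w, by simp [BTree.words, hw]⟩
    obtain ⟨w, hw⟩ := hne l
    have h0 := h (false :: w) (by simp [BTree.words, hw])
    obtain ⟨d, rfl⟩ : ∃ k, d = k + 1 := ⟨d - 1, by simp at h0; omega⟩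
    have h1 := ihl (d := d) fun w hw => by
      have := h (false :: w) (by simp [BTree.words, hw])
      simpa using this
    have h2 := ihr (d := d) fun w hw => by
      have := h (true :: w) (by simp [BTree.words, hw])
      simpa using this
    simp only [BTree.words, List.length_append, List.length_map, pow_succ]
    omega

theorem length_leaves_gridTree_le (T : Fin n → BTree) {d : ℕ}
    (h : ∀ i, ∀ w ∈ (T i).words, w.length ≤ d) :
    (gridTree T).leaves.length ≤ 2 ^ (n * d) := by
  have key : ∀ L : List (Fin n),
      (L.foldr (fun i t => (T i).hang i t) DTree.leaf).leaves.length ≤ 2 ^ (L.length * d) := by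
    intro L
    induction L with
    | nil => simp [DTree.leaves]
    | cons i L ih =>
      rw [List.foldr_cons, BTree.length_leaves_hang, List.length_cons, Nat.succ_mul, pow_add,
        mul_comm]
      exact Nat.mul_le_mul ih ((T i).length_words_le (h i))
  simpa [gridTree] using key (List.finRange n)

/-- The tree all of whose leaves have depth `m`. -/
def BTree.full : ℕ → BTree
  | 0 => .leaf
  | m + 1 => .caret (BTree.full m) (BTree.full m)

theorem BTree.mem_words_full (m : ℕ) (w : List Bool) :
    w ∈ (BTree.full m).words ↔ w.length = m := by
  induction m generalizing w with
  | zero => simp [BTree.full, BTree.words]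
  | succ m ih =>
    rcases w with _ | ⟨_ | _, w⟩ <;> simp [BTree.full, BTree.words, ih]

/-- Trees may be attached to the leaves of a tree. -/
theorem DTree.exists_graft (t : DTree n) (Q : Block n → Prop)
    (h : ∀ c ∈ t.leaves, ∃ s : DTree n, ∀ d ∈ s.leaves, Q (c.cat d)) :
    ∃ t' : DTree n, ∀ d ∈ t'.leaves, Q d := by
  induction t generalizing Q with
  | leaf => exact h Block.root (by simp only [DTree.leaves, List.mem_singleton]; rfl)
  | caret i l r ihl ihr =>
    obtain ⟨l', hl⟩ := ihl (fun b => Q (b.inHalf i false)) fun c hc => by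
      simpa only [Block.inHalf_cat] using h (c.inHalf i false)
        (List.mem_append.2 (.inl (List.mem_map_of_mem hc)))
    obtain ⟨r', hr⟩ := ihr (fun b => Q (b.inHalf i true)) fun c hc => by
      simpa only [Block.inHalf_cat] using h (c.inHalf i true)
        (List.mem_append.2 (.inr (List.mem_map_of_mem hc)))
    refine ⟨.caret i l' r', fun d hd => ?_⟩
    simp only [DTree.leaves, List.mem_append, List.mem_map] at hd
    rcases hd with ⟨d, hd, rfl⟩ | ⟨d, hd, rfl⟩
    exacts [hl d hd, hr d hd]

/-! ### Existence of grid diagrams -/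

/-- It suffices that every target block is the image of some grid block: the target blocks cover the
cube and the grid blocks are disjoint, so every grid block is used exactly once. -/
theorem exists_gridDiagram (x : Equiv.Perm (Cube n)) (T : Fin n → BTree) (t : DTree n)
    (h : ∀ c ∈ t.leaves, ∃ g ∈ (gridTree T).leaves, MapsBlock x g c) :
    ∃ D : GridDiagram n, D.coords = T ∧ D.toTreePair.Represents x := by
  have h' : ∀ k : Fin t.leaves.length, ∃ j : Fin (gridTree T).leaves.length,
      MapsBlock x ((gridTree T).leaves.get j) (t.leaves.get k) := by
    intro k
    obtain ⟨g, hg, hm⟩ := h _ (t.leaves.get_mem k)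
    obtain ⟨j, rfl⟩ := List.get_of_mem hg
    exact ⟨j, hm⟩
  choose φ hφ using h'
  have hbij : Function.Bijective φ := by
    constructor
    · intro k k' e
      have := hφ k'
      rw [← e] at this
      exact (List.nodup_iff_injective_get.1 t.nodup_leaves) ((hφ k).target_unique this)
    · intro j
      let z : Cube n := fun _ => Stream'.const false
      obtain ⟨c, hc, s, hs⟩ := t.exists_leaf_embed (x (((gridTree T).leaves.get j).embed z))
      obtain ⟨k, rfl⟩ := List.get_of_mem hc
      rw [← hφ k s] at hs
      refine ⟨k, (List.nodup_iff_injective_get.1 (gridTree T).nodup_leaves) ?_⟩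
      exact ((gridTree T).eq_of_embed_eq (List.get_mem _ _) (List.get_mem _ _)
        (x.injective hs)).symm
  refine ⟨⟨T, t, (Equiv.ofBijective φ hbij).symm⟩, rfl, fun j => ?_⟩
  have := hφ ((Equiv.ofBijective φ hbij).symm j)
  rwa [show φ ((Equiv.ofBijective φ hbij).symm j) = j from
    (Equiv.ofBijective φ hbij).apply_symm_apply j] at this

/-- Blocks that are small enough in all directions are mapped affinely onto blocks, and the words
that describe them grow by a bounded amount. -/
def BlockBound (x : Cube n → Cube n) (K : ℕ) : Prop :=
  ∀ b : Block n, (∀ i, K ≤ (b i).length) →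
    ∃ c, MapsBlock x b c ∧ ∀ i, (c i).length ≤ (b i).length + K

theorem exists_blockBound (x : nV n) : ∃ K, BlockBound (x : Equiv.Perm (Cube n)) K := by
  obtain ⟨t, ht⟩ := x.2
  obtain ⟨K, hK⟩ := DTree.exists_bound ht
  refine ⟨t.carets + K, fun b hb => ?_⟩
  obtain ⟨c, hc, w, rfl⟩ := t.exists_leaf_prefix b fun i => by have := hb i; omega
  obtain ⟨d, hd, hl⟩ := hK c hc
  refine ⟨_, hd.append w, fun i => ?_⟩
  have := hl i
  simp only [List.length_append]
  omega

theorem exists_gridDiagram_of_blockBound {x : Equiv.Perm (Cube n)} {K : ℕ}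
    (hx : BlockBound x K) : ∃ D : GridDiagram n, D.toTreePair.Represents x := by
  suffices ∃ t : DTree n, ∀ c ∈ t.leaves,
      ∃ g ∈ (gridTree fun _ : Fin n => BTree.full (3 * K)).leaves, MapsBlock x g c by
    obtain ⟨t, ht⟩ := this
    obtain ⟨D, -, hD⟩ := exists_gridDiagram x _ t ht
    exact ⟨D, hD⟩
  -- The target tree is grown from the uniform one of depth `2 * K`. A block of depth `K` has an
  -- image of depth at most `2 * K`, so each uniform block `q` lies inside the image of one such
  -- block.
  obtain ⟨v, hv⟩ := DTree.exists_uniform (n := n) (2 * K)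
  refine v.exists_graft _ fun q hq => ?_
  have hlen := hv q hq
  let z : Cube n := fun _ => Stream'.const false
  let y : Cube n := x⁻¹ (q.embed z)
  obtain ⟨c, hc, hl⟩ := hx (fun i => (y i).take K) (by simp)
  have hy : q.embed z = c.embed (fun i => (y i).drop K) := by
    rw [← hc]
    have : Block.embed (fun i => (y i).take K) (fun i => (y i).drop K) = y := by
      funext i; simp [Block.embed, Stream'.append_take_drop]
    rw [this]; simp [y]
  obtain ⟨w, hw⟩ := Block.prefix_of_embed_eq hy fun i => by
    have := hl i
    rw [hlen]; simp at this; omega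
  -- The preimage of `q` has depth `K + (w i).length` in direction `i`; this refinement brings all
  -- preimages to the common depth `3 * K`.
  refine ⟨gridTree fun i => BTree.full (2 * K - (w i).length), fun d hd => ?_⟩
  rw [mem_leaves_gridTree] at hd
  refine ⟨Block.cat (Block.cat (fun i => (y i).take K) w) d, ?_, ?_⟩
  · rw [mem_leaves_gridTree]
    intro i
    have h1 := hd i
    have h2 := congrArg List.length (congrFun hw i)
    rw [BTree.mem_words_full] at h1 ⊢
    rw [hlen, List.length_append] at h2
    simp [h1]
    omega
  · rw [hw]
    exact (hc.cat w).cat d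

theorem BTree.Erase.length_words {t t' : BTree} (h : t.Erase t') :
    t'.words.length < t.words.length := by
  induction h with
  | exposed => simp [BTree.words]
  | left r h ih => simpa [BTree.words] using ih
  | right l h ih => simpa [BTree.words] using ih

theorem exists_isReducedFor (x : nV n) :
    ∃ D : GridDiagram n, D.IsReducedFor (x : Equiv.Perm (Cube n)) := by
  classical
  obtain ⟨K, hK⟩ := exists_blockBound x
  have hex : ∃ k, ∃ D : GridDiagram n, D.toTreePair.Represents (x : Equiv.Perm (Cube n)) ∧
      ∑ i, (D.coords i).words.length = k :=
    (exists_gridDiagram_of_blockBound hK).elim fun D hD => ⟨_, D, hD, rfl⟩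
  -- A diagram with the least total number of leaves in its coordinate trees is reduced, as erasing
  -- a caret lowers this number.
  obtain ⟨D, hD, hk⟩ := Nat.find_spec hex
  refine ⟨D, hD, ?_⟩
  rintro i t' he ⟨D', hc, hD'⟩
  refine Nat.find_min hex ?_ ⟨D', hD', rfl⟩
  rw [← hk, hc]
  refine Finset.sum_lt_sum (fun j _ => ?_) ⟨i, Finset.mem_univ i, by simpa using he.length_words⟩
  by_cases h : j = i
  · subst h; simpa using he.length_words.le
  · simp [h]

end Grid

/-! ### Erasing deep carets -/

section Erase

variable {n : ℕ}

/-- Descending from the parent of a leaf into any child that is not a leaf ends at an exposed caret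
whose leaves are at least as deep; `u` is the position of that caret. -/
theorem BTree.exists_erase (T : BTree) {w : List Bool} (hw : w ∈ T.words) (h : 1 ≤ w.length) :
    ∃ t' u, T.Erase t' ∧ w.length ≤ u.length + 1 ∧ u ∈ t'.words ∧
      ∀ v ∈ T.words, v ∈ t'.words ∨ ∃ a, v = u ++ [a] := by
  have leaf_or : ∀ T : BTree, T = .leaf ∨ ∃ w ∈ T.words, 1 ≤ w.length := by
    intro T
    rcases T with _ | ⟨l, r⟩
    · exact Or.inl rfl
    · right
      have hne : ∀ T : BTree, ∃ w, w ∈ T.words := by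
        intro T
        induction T with
        | leaf => exact ⟨[], by simp [BTree.words]⟩
        | caret l r ihl _ => exact ihl.elim fun w hw => ⟨false :: w, by simp [BTree.words, hw]⟩
      obtain ⟨w, hw⟩ := hne l
      exact ⟨false :: w, by simp [BTree.words, hw], by simp⟩
  induction T generalizing w with
  | leaf =>
    simp only [BTree.words, List.mem_singleton] at hw
    simp [hw] at h
  | caret l r ihl ihr =>
    have inLeft : ∀ w' ∈ l.words, 1 ≤ w'.length → w.length ≤ w'.length + 1 →
        ∃ t' u, (BTree.caret l r).Erase t' ∧ w.length ≤ u.length + 1 ∧ u ∈ t'.words ∧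
          ∀ v ∈ (BTree.caret l r).words, v ∈ t'.words ∨ ∃ a, v = u ++ [a] := by
      intro w' hw' h1 h2
      obtain ⟨t', u, he, hl, hu, hv⟩ := ihl hw' h1
      refine ⟨.caret t' r, false :: u, .left r he, by simp; omega, by simp [BTree.words, hu], ?_⟩
      intro v hv'
      simp only [BTree.words, List.mem_append, List.mem_map] at hv' ⊢
      rcases hv' with ⟨v, hv', rfl⟩ | hv'
      · rcases hv v hv' with h | ⟨a, rfl⟩
        · exact Or.inl (Or.inl ⟨v, h, rfl⟩)
        · exact Or.inr ⟨a, rfl⟩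
      · exact Or.inl (Or.inr hv')
    have inRight : ∀ w' ∈ r.words, 1 ≤ w'.length → w.length ≤ w'.length + 1 →
        ∃ t' u, (BTree.caret l r).Erase t' ∧ w.length ≤ u.length + 1 ∧ u ∈ t'.words ∧
          ∀ v ∈ (BTree.caret l r).words, v ∈ t'.words ∨ ∃ a, v = u ++ [a] := by
      intro w' hw' h1 h2
      obtain ⟨t', u, he, hl, hu, hv⟩ := ihr hw' h1
      refine ⟨.caret l t', true :: u, .right l he, by simp; omega, by simp [BTree.words, hu], ?_⟩
      intro v hv'
      simp only [BTree.words, List.mem_append, List.mem_map] at hv' ⊢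
      rcases hv' with hv' | ⟨v, hv', rfl⟩
      · exact Or.inl (Or.inl hv')
      · rcases hv v hv' with h | ⟨a, rfl⟩
        · exact Or.inl (Or.inr ⟨v, h, rfl⟩)
        · exact Or.inr ⟨a, rfl⟩
    by_cases hw1 : w.length = 1
    · rcases leaf_or l with rfl | ⟨w', hw', h1⟩
      · rcases leaf_or r with rfl | ⟨w', hw', h1⟩
        · refine ⟨.leaf, [], .exposed, by simp [hw1], by simp [BTree.words], ?_⟩
          intro v hv
          right
          simpa [BTree.words] using hv
        · exact inRight w' hw' h1 (by omega)
      · exact inLeft w' hw' h1 (by omega)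
    · simp only [BTree.words, List.mem_append, List.mem_map] at hw
      rcases hw with ⟨w, hw, rfl⟩ | ⟨w, hw, rfl⟩
      · exact inLeft w hw (by simp at hw1; exact List.length_pos_iff.2 hw1) (by simp)
      · exact inRight w hw (by simp at hw1; exact List.length_pos_iff.2 hw1) (by simp)

theorem BTree.exists_subtree (T : BTree) {z w : List Bool} (h : z ++ w ∈ T.words) :
    ∃ t : BTree, ∀ v ∈ t.words, z ++ v ∈ T.words := by
  induction z generalizing T with
  | nil => exact ⟨T, fun v hv => hv⟩
  | cons a z ih =>
    rcases T with _ | ⟨l, r⟩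
    · simp [BTree.words] at h
    · cases a
      · obtain ⟨t, ht⟩ := ih l (by simpa [BTree.words] using h)
        exact ⟨t, fun v hv => by simpa [BTree.words] using ht v hv⟩
      · obtain ⟨t, ht⟩ := ih r (by simpa [BTree.words] using h)
        exact ⟨t, fun v hv => by simpa [BTree.words] using ht v hv⟩

/-- The subdivision that `t` induces on the lower face of the cube in direction `i`. -/
def DTree.slice (i : Fin n) : DTree n → DTree n
  | .leaf => .leaf
  | .caret j l r => if j = i then l.slice i else .caret j (l.slice i) (r.slice i)

theorem DTree.mem_leaves_slice (i : Fin n) (t : DTree n) {R : Block n}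
    (hR : R ∈ (t.slice i).leaves) :
    R i = [] ∧ ∃ k, Function.update R i (List.replicate k false) ∈ t.leaves := by
  induction t generalizing R with
  | leaf =>
    simp only [DTree.slice, DTree.leaves, List.mem_singleton] at hR ⊢
    subst hR
    exact ⟨rfl, 0, by simp⟩
  | caret j l r ihl ihr =>
    rw [DTree.slice] at hR
    split_ifs at hR with hj
    · subst hj
      obtain ⟨h0, k, hk⟩ := ihl hR
      refine ⟨h0, k + 1, List.mem_append.2 (.inl (List.mem_map.2 ⟨_, hk, ?_⟩))⟩
      simp [Block.inHalf, List.replicate_succ]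
    · have hij : i ≠ j := fun h => hj h.symm
      have key : ∀ (a : Bool) (R : Block n) (k : ℕ),
          Function.update (R.inHalf j a) i (List.replicate k false) =
            Block.inHalf j a (Function.update R i (List.replicate k false)) := by
        intro a R k
        simp only [Block.inHalf, Function.update_of_ne hj]
        exact Function.update_comm hj _ _ _
      simp only [DTree.leaves, List.mem_append, List.mem_map] at hR ⊢
      rcases hR with ⟨R, hR, rfl⟩ | ⟨R, hR, rfl⟩
      · obtain ⟨h0, k, hk⟩ := ihl hR
        exact ⟨by rw [Block.inHalf_of_ne hij, h0], k, .inl ⟨_, hk, (key _ _ _).symm⟩⟩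
      · obtain ⟨h0, k, hk⟩ := ihr hR
        exact ⟨by rw [Block.inHalf_of_ne hij, h0], k, .inr ⟨_, hk, (key _ _ _).symm⟩⟩

/-- Refining `g` by `w` makes room for a prefix block `β` of depth exactly `K`, on which the bound
applies. Thus `g` and `c`, refined alike, differ only by short prefixes `β`, `β'` before a common
tail `v`. -/
theorem BlockBound.compare {x : Cube n → Cube n} {K : ℕ} (hx : BlockBound x K) {g c : Block n}
    (h : MapsBlock x g c) (w : Block n) (hw : ∀ j, (w j).length = K) :
    ∃ β β' v : Block n, MapsBlock x β β' ∧ (∀ j, (β j).length = K) ∧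
      (∀ j, (β' j).length ≤ 2 * K) ∧ (∀ j, β j ++ v j = g j ++ w j) ∧
      ∀ j, β' j ++ v j = c j ++ w j := by
  let β : Block n := fun j => ((g.cat w) j).take K
  let v : Block n := fun j => ((g.cat w) j).drop K
  have hβ : ∀ j, (β j).length = K := fun j => by simp [β, hw j]
  obtain ⟨β', hm, hl⟩ := hx β fun j => (hβ j).ge
  have hcat : β.cat v = g.cat w := by
    funext j
    exact List.take_append_drop K _
  have h1 := hm.cat v
  rw [hcat] at h1
  have h2 := h1.target_unique (h.cat w)
  exact ⟨β, β', v, hm, hβ, fun j => by have := hl j; rw [hβ] at this; omega,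
    fun j => congrFun hcat j, fun j => congrFun h2 j⟩

/-- `BlockBound` limits only growth; comparing lengths of the common tail shows that it limits
shrinking too, for every block mapped to a block. -/
theorem BlockBound.length_le {x : Cube n → Cube n} {K : ℕ} (hx : BlockBound x K) {g c : Block n}
    (h : MapsBlock x g c) (i : Fin n) : (g i).length ≤ (c i).length + K := by
  obtain ⟨β, β', v, -, hβ, -, h1, h2⟩ := hx.compare h (fun _ => List.replicate K false) (by simp)
  have e1 := congrArg List.length (h1 i)
  have e2 := congrArg List.length (h2 i)
  simp only [List.length_append, hβ, List.length_replicate] at e1 e2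
  omega

/-- A map that is affine on a block whose image has large depth in direction `i` is affine on
the enlargement of the block in direction `i` to a smaller such depth. -/
theorem BlockBound.exists_enlarge {x : Cube n → Cube n} {K : ℕ} (hx : BlockBound x K)
    {g N : Block n} {i : Fin n} {r : List Bool} (hN : 2 * K ≤ (N i).length)
    (h : MapsBlock x g (Function.update N i (N i ++ r))) :
    ∃ z, g i = z ++ r ∧ z.length ≤ (N i).length + K ∧ MapsBlock x (Function.update g i z) N := by
  have key : ∀ w : Block n, (∀ j, (w j).length = K) → ∃ β β' v : Block n, ∃ m : List Bool,
      MapsBlock x β β' ∧ (β i).length = K ∧ N i = β' i ++ m ∧ g i = (β i ++ m) ++ r ∧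
      (∀ j, β j ++ v j = g j ++ w j) ∧ ∀ j, j ≠ i → β' j ++ v j = N j ++ w j := by
    intro w hw
    obtain ⟨β, β', v, hm, hβ, hβ', h1, h2⟩ := hx.compare h w hw
    have h2i := h2 i
    simp only [Function.update_self, List.append_assoc] at h2i
    -- The short prefix `β' i` ends inside `N i`, so `r` belongs entirely to the common tail and can
    -- be removed on both sides.
    have hp : β' i <+: N i := List.prefix_of_prefix_length_le (l₃ := β' i ++ v i)
      (List.prefix_append _ _) (by rw [h2i]; exact List.prefix_append _ _)
      ((hβ' i).trans hN)
    obtain ⟨m, hm'⟩ := hp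
    have hv : v i = m ++ (r ++ w i) := by
      rw [← hm', List.append_assoc] at h2i
      exact List.append_cancel_left h2i
    have h1i := h1 i
    rw [hv, ← List.append_assoc, ← List.append_assoc] at h1i
    refine ⟨β, β', v, m, hm, hβ i, hm'.symm, (List.append_cancel_right h1i).symm, h1, ?_⟩
    intro j hj
    simpa [hj] using h2 j
  obtain ⟨β, β', v, m, -, hβ, hNi, hg, -, -⟩ := key (fun _ => List.replicate K false) (by simp)
  refine ⟨β i ++ m, hg, ?_, ?_⟩
  · rw [hNi]
    simp only [List.length_append, hβ]
    omega
  -- The word `z` is determined by `g i = z ++ r`, so it is the same for every refinement `w`.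
  generalize β i ++ m = z at hg
  clear hNi hβ β β' v m
  intro s
  -- Refining by the first `K` digits of `s` gives a block `β` that contains the given point of the
  -- enlarged block and on which `x` is affine.
  obtain ⟨β, β', v, m, hm, -, hNi, hg', h1, h2⟩ := key (fun j => (s j).take K) (by simp)
  have hz : z = β i ++ m := List.append_cancel_right (hg.symm.trans hg')
  let s' : Cube n := fun j => if j = i then m ++ₛ s j else v j ++ₛ (s j).drop K
  have e1 : Block.embed (Function.update g i z) s = β.embed s' := by
    funext j
    by_cases hj : j = i
    · subst hj
      simp [Block.embed, s', hz, Stream'.append_append_stream]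
    · simp only [Block.embed, s', hj, Function.update_of_ne hj, if_false]
      rw [← Stream'.append_append_stream, h1 j, Stream'.append_append_stream,
        Stream'.append_take_drop]
  have e2 : N.embed s = β'.embed s' := by
    funext j
    by_cases hj : j = i
    · subst hj
      simp [Block.embed, s', hNi, Stream'.append_append_stream]
    · simp only [Block.embed, s', hj, if_false]
      rw [← Stream'.append_append_stream, h2 j hj, Stream'.append_append_stream,
        Stream'.append_take_drop]
  rw [e1, e2, hm]

/-- The target tree is kept as long as the depth in direction `i` is below `2 * K`. Below that, the
subdivision along one face, extended to whole columns in direction `i`, replaces the old one, and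
only the new `i`-th tree decides how the columns are cut. -/
theorem BlockBound.exists_tree_erase {x : Cube n → Cube n} {K : ℕ} (hx : BlockBound x K)
    {T : Fin n → BTree} {i : Fin n} {t' : BTree} {u : List Bool}
    (hT : ∀ v ∈ (T i).words, v ∈ t'.words ∨ ∃ a, v = u ++ [a]) (hu : u ∈ t'.words)
    (hlen : 3 * K ≤ u.length) (t : DTree n) (N : Block n) (hN : (N i).length ≤ 2 * K)
    (ht : ∀ c ∈ t.leaves, ∃ g ∈ (gridTree T).leaves, MapsBlock x g (N.cat c)) :
    ∃ s : DTree n, ∀ c ∈ s.leaves, ∃ g ∈ (gridTree (Function.update T i t')).leaves,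
      MapsBlock x g (N.cat c) := by
  have mem_update : ∀ (g : Block n) (v : List Bool), g ∈ (gridTree T).leaves → v ∈ t'.words →
      Function.update g i v ∈ (gridTree (Function.update T i t')).leaves := by
    intro g v hg hv
    rw [mem_leaves_gridTree] at hg ⊢
    intro j
    by_cases hj : j = i
    · subst hj; simpa using hv
    · simpa [hj] using hg j
  induction t generalizing N with
  | leaf =>
    obtain ⟨g, hg, hm⟩ := ht Block.root (by simp only [DTree.leaves, List.mem_singleton]; rfl)
    rcases hT (g i) ((mem_leaves_gridTree T g).1 hg i) with h | ⟨a, ha⟩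
    · refine ⟨.leaf, fun c hc => ⟨g, by simpa using mem_update g _ hg h, ?_⟩⟩
      simp only [DTree.leaves, List.mem_singleton] at hc
      subst hc
      exact hm
    -- An image this shallow in direction `i` comes from a block of depth at most `3 * K`, while the
    -- erased leaves have depth greater than `3 * K`.
    · have := hx.length_le hm i
      rw [Block.cat_root, ha, List.length_append, List.length_singleton] at this
      omega
  | caret j l r ihl ihr =>
    by_cases hN2 : (N i).length = 2 * K
    · refine DTree.exists_graft ((DTree.caret j l r).slice i) _ fun R hR => ?_
      obtain ⟨hR0, k, hk⟩ := DTree.mem_leaves_slice i _ hR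
      obtain ⟨g, hg, hm⟩ := ht _ hk
      have hNR : N.cat (Function.update R i (List.replicate k false)) =
          Function.update (N.cat R) i (N.cat R i ++ List.replicate k false) := by
        funext j
        by_cases hj : j = i
        · subst hj; simp [hR0]
        · simp [hj]
      have hNRi : (N.cat R i).length = 2 * K := by simp [hR0, hN2]
      rw [hNR] at hm
      obtain ⟨z, hz, hzl, hm'⟩ := hx.exists_enlarge hNRi.ge hm
      -- The interval `z` of the enlarged column is a vertex of the new tree: even if `g i` was an
      -- erased leaf, `z` has length at most `3 * K` and so is a prefix of `u`.
      obtain ⟨w, hw⟩ : ∃ w, z ++ w ∈ t'.words := by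
        rcases hT (g i) ((mem_leaves_gridTree T g).1 hg i) with h | ⟨a, ha⟩
        · exact ⟨_, hz ▸ h⟩
        · have hp : z <+: u := List.prefix_of_prefix_length_le (l₃ := g i)
            (by rw [hz]; exact List.prefix_append _ _) (by rw [ha]; exact List.prefix_append _ _)
            (by omega)
          obtain ⟨w, rfl⟩ := hp
          exact ⟨w, hu⟩
      obtain ⟨τ, hτ⟩ := t'.exists_subtree hw
      -- Cutting the column by the subtree of `t'` at `z` makes the preimages blocks of the new
      -- grid.
      refine ⟨τ.hang i .leaf, fun d hd => ?_⟩
      rw [BTree.mem_leaves_hang] at hd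
      obtain ⟨v, hv, c, hc, rfl⟩ := hd
      simp only [DTree.leaves, List.mem_singleton] at hc
      subst hc
      refine ⟨_, mem_update g _ hg (hτ v hv), ?_⟩
      have h := hm'.cat (Function.update Block.root i v)
      convert h using 1
      · funext j
        by_cases hj : j = i
        · subst hj; simp
        · simp [hj]
      · rw [← Block.cat_assoc]
        congr 1
        simp only [List.append_nil]
        rfl
    · have hlt : (N i).length < 2 * K := by omega
      have hcat : ∀ (a : Bool) (c : Block n),
          (N.cat (Block.root.inHalf j a)).cat c = N.cat (c.inHalf j a) := by
        intro a c
        rw [Block.cat_assoc, ← Block.inHalf_eq_cat]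
      have hNa : ∀ a : Bool, (N.cat (Block.root.inHalf j a) i).length ≤ 2 * K := by
        intro a
        by_cases h : i = j
        · subst h; simp [Block.inHalf_self]; omega
        · simp [Block.inHalf_of_ne h]; omega
      obtain ⟨l', hl⟩ := ihl _ (hNa false) fun c hc => by
        rw [hcat]
        exact ht _ (List.mem_append.2 (.inl (List.mem_map_of_mem hc)))
      obtain ⟨r', hr⟩ := ihr _ (hNa true) fun c hc => by
        rw [hcat]
        exact ht _ (List.mem_append.2 (.inr (List.mem_map_of_mem hc)))
      refine ⟨.caret j l' r', fun c hc => ?_⟩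
      simp only [DTree.leaves, List.mem_append, List.mem_map] at hc
      rcases hc with ⟨c, hc, rfl⟩ | ⟨c, hc, rfl⟩
      · rw [← hcat]; exact hl c hc
      · rw [← hcat]; exact hr c hc

/-- The depth of the coordinate trees of a reduced grid diagram is bounded. -/
theorem GridDiagram.IsReducedFor.length_words_le {x : Equiv.Perm (Cube n)} {D : GridDiagram n}
    (hD : D.IsReducedFor x) {K : ℕ} (hx : BlockBound x K) (i : Fin n) {w : List Bool}
    (hw : w ∈ (D.coords i).words) : w.length ≤ 3 * K + 1 := by
  by_contra! hlt
  obtain ⟨t', u, he, hl, hu, hT⟩ := (D.coords i).exists_erase hw (by omega)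
  refine hD.2 i t' he ?_
  obtain ⟨s, hs⟩ := hx.exists_tree_erase hT hu (by omega) D.target Block.root (by simp) (by
    intro c hc
    obtain ⟨k, rfl⟩ := List.get_of_mem hc
    refine ⟨_, List.get_mem _ (D.perm.symm k), ?_⟩
    have : MapsBlock x ((gridTree D.coords).leaves.get (D.perm.symm k))
        (D.target.leaves.get (D.perm (D.perm.symm k))) := hD.1 _
    rw [Equiv.apply_symm_apply] at this
    exact this)
  exact exists_gridDiagram x _ s hs

theorem GridDiagram.IsReducedFor.carets_le {x : Equiv.Perm (Cube n)} {D : GridDiagram n}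
    (hD : D.IsReducedFor x) {K : ℕ} (hx : BlockBound x K) :
    D.carets ≤ 2 ^ (n * (3 * K + 1)) := by
  have h := length_leaves_gridTree_le D.coords (d := 3 * K + 1)
    fun i w hw => hD.length_words_le hx i hw
  rw [DTree.length_leaves] at h
  exact (Nat.le_succ _).trans h

/-- Since `y` shrinks words by at most `L`, the image of a block of depth `K + L` still has the
depth `K` that `x` needs. -/
theorem BlockBound.mul {x y : Equiv.Perm (Cube n)} {K L : ℕ} (hx : BlockBound x K)
    (hy : BlockBound y L) : BlockBound (x * y : Equiv.Perm (Cube n)) (K + L) := by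
  intro b hb
  obtain ⟨c, hc, hl⟩ := hy b fun i => by have := hb i; omega
  obtain ⟨d, hd, hl'⟩ := hx c fun i => by
    have h1 := hy.length_le hc i
    have h2 := hb i
    omega
  exact ⟨d, hc.trans hd, fun i => by have := hl i; have := hl' i; omega⟩

theorem BlockBound.one : BlockBound (1 : Equiv.Perm (Cube n)) 0 :=
  fun b _ => ⟨b, fun _ => rfl, fun _ => le_rfl⟩

theorem BlockBound.mono {x : Cube n → Cube n} {K L : ℕ} (hx : BlockBound x K) (h : K ≤ L) :
    BlockBound x L := fun b hb =>
  let ⟨c, hc, hl⟩ := hx b fun i => h.trans (hb i)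
  ⟨c, hc, fun i => (hl i).trans (by omega)⟩

theorem BlockBound.list_prod {K : ℕ} (w : List (nV n))
    (hw : ∀ g ∈ w, BlockBound (g : Equiv.Perm (Cube n)) K) :
    BlockBound (w.prod : Equiv.Perm (Cube n)) (K * w.length) := by
  induction w with
  | nil => simpa using BlockBound.one
  | cons g w ih =>
    have h := (hw g (by simp)).mul (ih fun g hg => hw g (by simp [hg]))
    rw [List.prod_cons, Subgroup.coe_mul]
    exact h.mono (by rw [List.length_cons, Nat.mul_succ, add_comm])

theorem exists_uniform_blockBound {S : Set (nV n)} (hS : S.Finite) :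
    ∃ K, ∀ g : nV n, g ∈ S ∨ g⁻¹ ∈ S → BlockBound (g : Equiv.Perm (Cube n)) K := by
  choose K hK using fun x : nV n => exists_blockBound x
  obtain ⟨B, hB⟩ := (hS.image fun g => K g + K g⁻¹).bddAbove
  refine ⟨B, fun g hg => ?_⟩
  rcases hg with hg | hg
  · exact (hK g).mono (le_trans (Nat.le_add_right _ _) (hB ⟨g, hg, rfl⟩))
  · refine (hK g).mono (le_trans ?_ (hB ⟨_, hg, rfl⟩))
    simp

end Erase

/-! ### Brin's generators -/

section Brin

variable {α κ : Type*}

theorem finite_brinGenerators : brinGenerators.Finite := by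
  have : brinGenerators = ⋃ D ∈ {D | D ∈ brinDiagrams},
      {g : nV 2 | D.Represents (g : Equiv.Perm (Cube 2))} := by
    ext g
    simp [brinGenerators]
  rw [this]
  refine (List.finite_toSet _).biUnion fun D _ => Set.Subsingleton.finite ?_
  intro g hg g' hg'
  refine Subtype.ext (perm_eq_of_mapsBlock D.source fun b hb => ?_)
  obtain ⟨j, rfl⟩ := List.get_of_mem hb
  exact ⟨_, hg j, hg' j⟩

/-- Some product of Brin's generators and their inverses carries the first tree
to the second one. -/
def Conn (T T' : LTree 2 α) : Prop :=
  ∃ x ∈ Subgroup.closure brinGenerators, Carries (x : Equiv.Perm (Cube 2)) T.leaves T'.leaves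

theorem Conn.of_perm {T T' : LTree 2 α} (h : T.leaves.Perm T'.leaves) : Conn T T' :=
  ⟨1, one_mem _, .of_mem_iff fun _ => h.mem_iff⟩

theorem Conn.of_eq {T T' : LTree 2 α} (h : T.leaves = T'.leaves) : Conn T T' :=
  .of_perm (h ▸ .refl _)

theorem Conn.trans {T T' T'' : LTree 2 α} (h : Conn T T') (h' : Conn T' T'') : Conn T T'' := by
  obtain ⟨x, hx, hc⟩ := h
  obtain ⟨y, hy, hc'⟩ := h'
  exact ⟨y * x, mul_mem hy hx, hc.trans hc'⟩

theorem Conn.symm {T T' : LTree 2 α} (h : Conn T T') : Conn T' T := by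
  obtain ⟨x, hx, hc⟩ := h
  exact ⟨x⁻¹, inv_mem hx, hc.symm⟩

theorem Conn.bind {e e' : LTree 2 κ} (f : κ → LTree 2 α)
    (h : Conn (e.bind (maskLeaf fun j => !(f j).leaves.isEmpty))
      (e'.bind (maskLeaf fun j => !(f j).leaves.isEmpty))) : Conn (e.bind f) (e'.bind f) := by
  obtain ⟨x, hx, hc⟩ := h
  exact ⟨x, hx, hc.bind f⟩

/-- The element represented by the diagram is constructed by `exists_carries`; the labels encode the
matching of the leaves. -/
theorem conn_of_diagram {D : TreePair 2} (hD : D ∈ brinDiagrams) {T T' : LTree 2 (Fin 4)}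
    (h : T.labels.Nodup) (h' : T'.labels.Nodup) (hmem : ∀ a, a ∈ T.labels ↔ a ∈ T'.labels)
    (hl : ∀ j, ∃ a, (D.source.leaves.get j, a) ∈ T.leaves ∧
      (D.target.leaves.get (D.perm j), a) ∈ T'.leaves) : Conn T T' := by
  obtain ⟨x, hx⟩ := exists_carries h h' hmem
  refine ⟨x, Subgroup.subset_closure ⟨D, hD, fun j => ?_⟩, hx⟩
  obtain ⟨a, h1, h2⟩ := hl j
  obtain ⟨q, hq, e, hm⟩ := hx.1 _ h1
  rw [← LTree.map_snd_leaves] at h'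
  obtain rfl : q = _ := List.inj_on_of_nodup_map h' hq h2 e
  exact hm

theorem conn_split_zero (d : Fin 2) :
    Conn (.node 0 (.node d (.leaf 1) (.leaf 2)) (.leaf 3) : LTree 2 (Fin 4))
      (.node 0 (.leaf 1) (.node 0 (.leaf 2) (.leaf 3))) := by
  refine conn_of_diagram (D := splitDiagram d 0) ?_ (by decide +revert) (by decide +revert)
    (by decide +revert) (by decide +revert)
  fin_cases d <;> simp [brinDiagrams]

theorem conn_split_one (d : Fin 2) :
    Conn (.node 0 (.leaf 0) (.node 0 (.node d (.leaf 1) (.leaf 2)) (.leaf 3)) : LTree 2 (Fin 4))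
      (.node 0 (.leaf 0) (.node 0 (.leaf 1) (.node 0 (.leaf 2) (.leaf 3)))) := by
  refine conn_of_diagram (D := splitDiagram d 1) ?_ (by decide +revert) (by decide +revert)
    (by decide +revert) (by decide +revert)
  fin_cases d <;> simp [brinDiagrams]

theorem conn_swap_zero :
    Conn (.node 0 (.leaf 1) (.node 0 (.leaf 2) (.leaf 3)) : LTree 2 (Fin 4))
      (.node 0 (.leaf 2) (.node 0 (.leaf 1) (.leaf 3))) :=
  conn_of_diagram (D := swapDiagram 2 0 (by norm_num)) (by simp [brinDiagrams]) (by decide)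
    (by decide) (by decide) (by decide)

theorem conn_swap_one :
    Conn (.node 0 (.leaf 0) (.node 0 (.leaf 1) (.node 0 (.leaf 2) (.leaf 3))) : LTree 2 (Fin 4))
      (.node 0 (.leaf 0) (.node 0 (.leaf 2) (.node 0 (.leaf 1) (.leaf 3)))) :=
  conn_of_diagram (D := swapDiagram 3 1 (by norm_num)) (by simp [brinDiagrams]) (by decide)
    (by decide) (by decide) (by decide)

theorem conn_swapLast_zero :
    Conn (.node 0 (.leaf 1) (.leaf 2) : LTree 2 (Fin 4)) (.node 0 (.leaf 2) (.leaf 1)) :=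
  conn_of_diagram (D := swapDiagram 1 0 (by norm_num)) (by simp [brinDiagrams]) (by decide)
    (by decide) (by decide) (by decide)

theorem conn_swapLast_one :
    Conn (.node 0 (.leaf 0) (.node 0 (.leaf 1) (.leaf 2)) : LTree 2 (Fin 4))
      (.node 0 (.leaf 0) (.node 0 (.leaf 2) (.leaf 1))) :=
  conn_of_diagram (D := swapDiagram 2 1 (by norm_num)) (by simp [brinDiagrams]) (by decide)
    (by decide) (by decide) (by decide)

/-- The two trees are connected inside any all-right comb; the subtree `z` in front of them may
be void. -/
def Conn₁ (T T' : LTree 2 α) : Prop := ∀ z, Conn (.node 0 z T) (.node 0 z T')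

theorem Conn₁.conn {T T' : LTree 2 α} (h : Conn₁ T T') : Conn T T' := h .nil

theorem Conn₁.of_perm {T T' : LTree 2 α} (h : T.leaves.Perm T'.leaves) : Conn₁ T T' := by
  intro z
  refine Conn.of_perm ?_
  simp only [LTree.leaves]
  by_cases hz : z.leaves = []
  · simpa [hz] using h
  by_cases hT : T.leaves = []
  · rw [hT] at h
    rw [hT, List.nil_perm.1 h]
  have hT' : T'.leaves ≠ [] := fun h0 => hT (by rw [h0] at h; exact List.perm_nil.1 h)
  rw [joinLeaves_of_ne_nil 0 hz hT, joinLeaves_of_ne_nil 0 hz hT']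
  exact (h.map _).append_left _

theorem Conn₁.of_eq {T T' : LTree 2 α} (h : T.leaves = T'.leaves) : Conn₁ T T' :=
  .of_perm (h ▸ .refl _)

theorem Conn₁.trans {T T' T'' : LTree 2 α} (h : Conn₁ T T') (h' : Conn₁ T' T'') :
    Conn₁ T T'' := fun z => (h z).trans (h' z)

theorem Conn₁.symm {T T' : LTree 2 α} (h : Conn₁ T T') : Conn₁ T' T := fun z => (h z).symm

/-- When `a` and `b` are nonvoid, the generators with index 0 or 1 apply according as `z` is void or
not. A void `c` would leave a caret of type `d` in last position, which no `A_i` or `B_i` treats. -/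
theorem conn₁_split (d : Fin 2) (a b c : LTree 2 α) (hc : c.leaves ≠ []) :
    Conn₁ (.node 0 (.node d a b) c) (.node 0 a (.node 0 b c)) := by
  by_cases ha : a.leaves = []
  · exact .of_eq (by simp [LTree.leaves, ha])
  by_cases hb : b.leaves = []
  · exact .of_eq (by simp [LTree.leaves, hb])
  intro z
  refine Conn.bind (e := .node 0 (.leaf 0) (.node 0 (.node d (.leaf 1) (.leaf 2)) (.leaf 3)))
    (e' := .node 0 (.leaf 0) (.node 0 (.leaf 1) (.node 0 (.leaf 2) (.leaf 3)))) ![z, a, b, c] ?_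
  by_cases hz : z.leaves = []
  · simpa [Conn, LTree.leaves, LTree.bind, maskLeaf, ha, hb, hc, hz] using conn_split_zero d
  · simpa [Conn, LTree.leaves, LTree.bind, maskLeaf, ha, hb, hc, hz] using conn_split_one d

theorem conn₁_assoc (a b c : LTree 2 α) :
    Conn₁ (.node 0 (.node 0 a b) c) (.node 0 a (.node 0 b c)) := by
  by_cases hc : c.leaves = []
  · exact .of_eq (by simp [LTree.leaves, hc])
  · exact conn₁_split 0 a b c hc

/-- For nonvoid `a` and `b`, voidness of `c` selects a barred swap, and voidness of `z` selects
index 0. -/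
theorem conn₁_swap (a b c : LTree 2 α) :
    Conn₁ (.node 0 a (.node 0 b c)) (.node 0 b (.node 0 a c)) := by
  by_cases ha : a.leaves = []
  · exact .of_eq (by simp [LTree.leaves, ha])
  by_cases hb : b.leaves = []
  · exact .of_eq (by simp [LTree.leaves, hb])
  intro z
  refine Conn.bind (e := .node 0 (.leaf 0) (.node 0 (.leaf 1) (.node 0 (.leaf 2) (.leaf 3))))
    (e' := .node 0 (.leaf 0) (.node 0 (.leaf 2) (.node 0 (.leaf 1) (.leaf 3)))) ![z, a, b, c] ?_
  by_cases hz : z.leaves = [] <;> by_cases hc : c.leaves = []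
  · simpa [Conn, LTree.leaves, LTree.bind, maskLeaf, ha, hb, hc, hz] using conn_swapLast_zero
  · simpa [Conn, LTree.leaves, LTree.bind, maskLeaf, ha, hb, hc, hz] using conn_swap_zero
  · simpa [Conn, LTree.leaves, LTree.bind, maskLeaf, ha, hb, hc, hz] using conn_swapLast_one
  · simpa [Conn, LTree.leaves, LTree.bind, maskLeaf, ha, hb, hc, hz] using conn_swap_one

theorem conn₁_comm (a b : LTree 2 α) : Conn₁ (.node 0 a b) (.node 0 b a) :=
  (Conn₁.of_eq (by simp [LTree.leaves])).trans
    ((conn₁_swap a b .nil).trans (.of_eq (by simp [LTree.leaves])))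

/-- By associativity `y` is absorbed into the front subtree; this is why `Conn₁` quantifies over
arbitrary trees `z`. Deeper positions therefore need no further generators. -/
theorem Conn₁.right {T T' : LTree 2 α} (h : Conn₁ T T') (y : LTree 2 α) :
    Conn₁ (.node 0 y T) (.node 0 y T') := fun z =>
  (conn₁_assoc z y T).conn.symm.trans ((h (.node 0 z y)).trans (conn₁_assoc z y T').conn)

theorem Conn₁.left {T T' : LTree 2 α} (h : Conn₁ T T') (y : LTree 2 α) :
    Conn₁ (.node 0 T y) (.node 0 T' y) :=
  (conn₁_comm T y).trans ((h.right y).trans (conn₁_comm y T'))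

/-- A caret of type `0` whose leaves are labelled by the two halves of `a`. -/
def halves (a : κ) : LTree 2 (κ × Bool) := .node 0 (.leaf (a, false)) (.leaf (a, true))

/-- A map that carries both halves of a block affinely to the corresponding halves of another
carries the whole block affinely. -/
theorem Conn.of_halves {e e' : LTree 2 κ} (h' : e'.labels.Nodup)
    (h : Conn (e.bind halves) (e'.bind halves)) : Conn e e' := by
  obtain ⟨x, hx, hc⟩ := h
  refine ⟨x, hx, ?_⟩
  have hl : ∀ e : LTree 2 κ, (e.bind halves).leaves =
      substLeaves (fun a => (halves a).leaves) e.leaves := by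
    intro e
    rw [LTree.leaves_bind]
    congr 2
    induction e with
    | nil => rfl
    | leaf a => rfl
    | node i l r ihl ihr => rw [LTree.bind, ihl, ihr]
  have hmem : ∀ (e : LTree 2 κ) (p : Block 2 × (κ × Bool)),
      p ∈ (e.bind halves).leaves ↔
        (p.1, p.2.1) ∈ e.leaves.map (Prod.map (·.cat (Block.root.inHalf 0 p.2.2)) id) := by
    rintro e ⟨b, a, i⟩
    rw [hl]
    simp only [substLeaves, halves, LTree.leaves, List.mem_flatMap, List.mem_map]
    constructor
    · rintro ⟨q, hq, u, hu, he⟩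
      simp [joinLeaves] at hu
      rcases hu with rfl | rfl <;> cases he <;> exact ⟨q, hq, rfl⟩
    · rintro ⟨q, hq, he⟩
      cases he
      refine ⟨q, hq, (Block.root.inHalf 0 i, (q.2, i)), ?_, rfl⟩
      cases i <;> simp [joinLeaves]
  have hjoin : ∀ b c : Block 2,
      (∀ i, MapsBlock x.1 (b.cat (Block.root.inHalf 0 i)) (c.cat (Block.root.inHalf 0 i))) →
        MapsBlock x.1 b c := by
    intro b c h s
    have hs : s = (Block.root.inHalf 0 (s 0).head : Block 2).embed
        (Function.update s 0 (s 0).tail) := by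
      funext j
      by_cases hj : j = 0
      · subst hj
        simp [Block.embed, Block.inHalf_self, Stream'.cons_append_stream, Stream'.eta]
      · simp [Block.embed, Block.inHalf_of_ne hj, hj]
    rw [hs, ← Block.embed_cat, ← Block.embed_cat]
    exact h _ _
  rw [← LTree.map_snd_leaves] at h'
  have key : ∀ p ∈ e.leaves, ∀ q ∈ e'.leaves, q.2 = p.2 → MapsBlock x.1 p.1 q.1 := by
    intro p hp q hq hpq
    refine hjoin _ _ fun i => ?_
    obtain ⟨r, hr, hr2, hm⟩ := hc.1 (p.1.cat (Block.root.inHalf 0 i), (p.2, i))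
      ((hmem _ _).2 (List.mem_map.2 ⟨p, hp, rfl⟩))
    obtain ⟨q', hq', he⟩ := List.mem_map.1 ((hmem _ _).1 hr)
    rw [hr2] at he
    have h1 := congrArg Prod.fst he
    have h2 := congrArg Prod.snd he
    simp only [Prod.map_fst, Prod.map_snd, id] at h1 h2
    obtain rfl : q' = q := List.inj_on_of_nodup_map h' hq' hq (h2.trans hpq.symm)
    rw [h1]
    exact hm
  constructor
  · intro p hp
    obtain ⟨r, hr, hr2, -⟩ := hc.1 (p.1.cat (Block.root.inHalf 0 true), (p.2, true))
      ((hmem _ _).2 (List.mem_map.2 ⟨p, hp, rfl⟩))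
    obtain ⟨q, hq, he⟩ := List.mem_map.1 ((hmem _ _).1 hr)
    have h2 := congrArg Prod.snd he
    rw [hr2] at h2
    exact ⟨q, hq, h2, key p hp q hq h2⟩
  · intro q hq
    obtain ⟨r, hr, hr2, -⟩ := hc.2 (q.1.cat (Block.root.inHalf 0 true), (q.2, true))
      ((hmem _ _).2 (List.mem_map.2 ⟨q, hq, rfl⟩))
    obtain ⟨p, hp, he⟩ := List.mem_map.1 ((hmem _ _).1 hr)
    have h2 := congrArg Prod.snd he
    rw [← hr2] at h2
    exact ⟨p, hp, h2.symm, key p hp q hq h2.symm⟩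

theorem conn₁_turn_refined (p₀ p₁ q₀ q₁ : α) :
    Conn₁ (.node 1 (.node 0 (.leaf p₀) (.leaf p₁)) (.node 0 (.leaf q₀) (.leaf q₁)))
      (.node 0 (.node 0 (.leaf p₀) (.leaf p₁)) (.node 0 (.leaf q₀) (.leaf q₁))) := by
  have ne : ∀ a : α, (LTree.leaf a : LTree 2 α).leaves ≠ [] := by simp [LTree.leaves]
  -- The four quarters of the square may also be cut vertically first. Each horizontal caret can
  -- then be split off while something nonvoid stands behind it.
  have h1 : Conn₁ (.node 1 (.node 0 (.leaf p₀) (.leaf p₁)) (.node 0 (.leaf q₀) (.leaf q₁)))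
      (.node 0 (.node 1 (.leaf p₀) (.leaf q₀)) (.node 1 (.leaf p₁) (.leaf q₁))) := by
    refine .of_perm ?_
    have hcomm : ∀ (a b : Bool) (w : Block 2),
        (w.inHalf 0 a).inHalf 1 b = (w.inHalf 1 b).inHalf 0 a := by
      intro a b w
      funext j
      fin_cases j <;> simp [Block.inHalf]
    simp only [LTree.leaves, joinLeaves, List.map_cons, List.map_nil, List.cons_append,
      List.nil_append, Prod.map_apply, id, hcomm]
    exact (List.Perm.swap _ _ _).cons _
  have h2 := conn₁_split 1 (.leaf p₀) (.leaf q₀) (.node 1 (.leaf p₁) (.leaf q₁))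
    (by simp [LTree.leaves, joinLeaves])
  have h3 := (conn₁_comm (.leaf q₀) (.node 1 (.leaf p₁) (.leaf q₁))).right (.leaf p₀)
  have h4 := (conn₁_split 1 (.leaf p₁) (.leaf q₁) (.leaf q₀) (ne _)).right (.leaf p₀)
  have h5 := ((conn₁_comm (.leaf q₁) (.leaf q₀)).right (.leaf p₁)).right (.leaf p₀)
  have h6 := (conn₁_assoc (.leaf p₀) (.leaf p₁) (.node 0 (.leaf q₀) (.leaf q₁))).symm
  exact ((((h1.trans h2).trans h3).trans h4).trans h5).trans h6

theorem conn₁_turn (d : Fin 2) (a b : LTree 2 α) : Conn₁ (.node d a b) (.node 0 a b) := by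
  by_cases hd : d = 0
  · subst hd; exact .of_eq rfl
  obtain rfl : d = 1 := by omega
  by_cases ha : a.leaves = []
  · exact .of_eq (by simp [LTree.leaves, ha])
  by_cases hb : b.leaves = []
  · exact .of_eq (by simp [LTree.leaves, hb])
  intro z
  refine Conn.bind (e := .node 0 (.leaf 0) (.node 1 (.leaf 1) (.leaf 2)))
    (e' := .node 0 (.leaf 0) (.node 0 (.leaf 1) (.leaf 2)))
    (![z, a, b] : Fin 3 → LTree 2 α) ?_
  refine Conn.of_halves ?_ ?_
  · rw [LTree.labels_bind_maskLeaf]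
    exact List.Nodup.filter _ (by decide)
  · simpa [LTree.bind, maskLeaf, ha, hb, halves] using conn₁_turn_refined _ _ _ _ _

theorem conn₁_comb_append (L M : List α) :
    Conn₁ (.node 0 (comb L) (comb M)) (comb (L ++ M) : LTree 2 α) := by
  induction L with
  | nil => exact .of_eq rfl
  | cons a L ih => exact (conn₁_assoc _ _ _).trans (ih.right _)

/-- Normal form: all carets are turned vertical and reassociated to the right. -/
theorem conn₁_comb_labels (T : LTree 2 α) : Conn₁ T (comb T.labels) := by
  induction T with
  | nil => exact .of_eq rfl
  | leaf a => exact .of_eq (by simp [LTree.labels, comb, LTree.leaves])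
  | node i l r ihl ihr =>
    exact (((conn₁_turn i l r).trans (ihl.left r)).trans (ihr.right _)).trans
      (conn₁_comb_append _ _)

theorem conn₁_comb_perm {L M : List α} (h : L.Perm M) : Conn₁ (comb L : LTree 2 α) (comb M) := by
  induction h with
  | nil => exact .of_eq rfl
  | cons a _ ih => exact ih.right _
  | swap a b L => exact conn₁_swap _ _ _
  | trans _ _ ih ih' => exact ih.trans ih'

theorem closure_brinGenerators : Subgroup.closure brinGenerators = ⊤ := by
  rw [eq_top_iff]
  intro x _
  obtain ⟨D, hD, -⟩ := exists_isReducedFor x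
  obtain ⟨f, hperm, hcar⟩ := hD.exists_carries
  rw [← LTree.labels_ofDTree] at hperm
  have hid : D.toTreePair.target.leaves = (LTree.ofDTree id D.toTreePair.target).labels := by
    rw [LTree.labels_ofDTree, List.map_id]
  rw [hid] at hperm
  obtain ⟨y, hy, hc⟩ := (((conn₁_comb_labels _).trans (conn₁_comb_perm hperm)).trans
    (conn₁_comb_labels _).symm).conn
  obtain rfl : x = y := Subtype.ext (hcar.unique_ofDTree hc)
  exact hy

end Brin

/-! ### Word length -/

section WordLength

theorem wordLength_le {G : Type*} [Group G] {S : Set G} {w : List G}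
    (hw : ∀ g ∈ w, g ∈ S ∨ g⁻¹ ∈ S) : wordLength S w.prod ≤ w.length :=
  Nat.sInf_le ⟨w, hw, rfl, rfl⟩

theorem exists_word {G : Type*} [Group G] {S : Set G} (hS : Subgroup.closure S = ⊤) (x : G) :
    ∃ w : List G, (∀ g ∈ w, g ∈ S ∨ g⁻¹ ∈ S) ∧ w.prod = x ∧ w.length = wordLength S x := by
  have hx : x ∈ (Subgroup.closure S).toSubmonoid := by rw [hS]; trivial
  rw [Subgroup.closure_toSubmonoid] at hx
  obtain ⟨w, hw, hp⟩ := Submonoid.exists_list_of_mem_closure hx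
  exact Nat.sInf_mem (s := {k | ∃ w : List G, (∀ g ∈ w, g ∈ S ∨ g⁻¹ ∈ S) ∧ w.prod = x ∧
    w.length = k}) ⟨_, w, hw, hp, rfl⟩

theorem wordLength_mul_le {G : Type*} [Group G] {S : Set G} (hS : Subgroup.closure S = ⊤)
    (x y : G) : wordLength S (x * y) ≤ wordLength S x + wordLength S y := by
  obtain ⟨v, hv, rfl, hl⟩ := exists_word hS x
  obtain ⟨w, hw, rfl, hl'⟩ := exists_word hS y
  rw [← hl, ← hl', ← List.prod_append, ← List.length_append]
  exact wordLength_le fun g hg => (List.mem_append.1 hg).elim (hv g) (hw g)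

theorem exists_wordLength_prod_le {G : Type*} [Group G] {S Γ : Set G}
    (hS : Subgroup.closure S = ⊤) (hΓ : Γ.Finite) :
    ∃ B : ℕ, ∀ w : List G, (∀ g ∈ w, g ∈ Γ ∨ g⁻¹ ∈ Γ) → wordLength S w.prod ≤ B * w.length := by
  obtain ⟨B, hB⟩ := (hΓ.image fun g => wordLength S g + wordLength S g⁻¹).bddAbove
  refine ⟨B, fun w => ?_⟩
  induction w with
  | nil => exact fun _ => wordLength_le (w := []) (by simp)
  | cons g w ih =>
    intro hw
    have hg : wordLength S g ≤ B := by
      rcases hw g (by simp) with h | h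
      · exact le_trans (Nat.le_add_right _ _) (hB ⟨g, h, rfl⟩)
      · refine le_trans ?_ (hB ⟨_, h, rfl⟩)
        simp
    have h1 := ih fun g hg => hw g (by simp [hg])
    rw [List.prod_cons, List.length_cons, Nat.mul_succ]
    exact (wordLength_mul_le hS _ _).trans (by omega)

/-! ### Numerical estimates and the two inequalities -/

theorem succ_mul_log_le (M : ℕ) :
    ((M + 1) * (2 * (Nat.log 2 M + 1) + 4) : ℝ) ≤ 32 * (M * Real.log M) + 12 := by
  rcases Nat.lt_or_ge M 2 with hM | hM
  -- The additive constant 12 is attained at `M = 1`, where the logarithm vanishes.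
  · interval_cases M <;> norm_num
  have hM' : (2 : ℝ) ≤ M := by exact_mod_cast hM
  have h2 : (1 / 2 : ℝ) ≤ Real.log 2 := by have := Real.log_two_gt_d9; linarith
  have hlog : Real.log 2 ≤ Real.log M := Real.log_le_log (by norm_num) hM'
  have hpow : ((2 : ℝ) ^ Nat.log 2 M) ≤ M := by
    exact_mod_cast Nat.pow_log_le_self 2 (by omega)
  have hL : (Nat.log 2 M : ℝ) * Real.log 2 ≤ Real.log M := by
    rw [← Real.log_pow]
    exact Real.log_le_log (by positivity) hpow
  have hL' : (Nat.log 2 M : ℝ) ≤ 2 * Real.log M := by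
    have : (0 : ℝ) ≤ Nat.log 2 M := by positivity
    nlinarith
  have h1 : (2 * (Nat.log 2 M + 1) + 4 : ℝ) ≤ 16 * Real.log M := by linarith
  have h0 : (0 : ℝ) ≤ 16 * Real.log M := by linarith
  calc ((M + 1) * (2 * (Nat.log 2 M + 1) + 4) : ℝ)
      ≤ (M + 1) * (16 * Real.log M) := by gcongr
    _ ≤ (2 * M) * (16 * Real.log M) := by gcongr; linarith
    _ ≤ 32 * (M * Real.log M) + 12 := by linarith

theorem exists_wordLength_bounds {n : ℕ} [NeZero n] {S : Set (nV n)} (hS : S.Finite)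
    (hcl : Subgroup.closure S = ⊤) :
    ∃ C : ℝ, 0 < C ∧
      ∀ (x : nV n) (D : GridDiagram n), D.IsReducedFor (x : Equiv.Perm (Cube n)) →
        Real.log D.carets ≤ C * wordLength S x + C ∧
        (wordLength S x : ℝ) ≤ C * (D.carets * Real.log D.carets) + C := by
  obtain ⟨K, hK⟩ := exists_uniform_blockBound hS
  obtain ⟨B, hB⟩ := exists_wordLength_prod_le hcl (finite_moves n)
  have hC : (0 : ℝ) < 32 * B + (3 * n * K + n) + 1 := by positivity
  -- `3 * n * K + n` comes from the depth bound for reduced diagrams, `32 * B` from the sorting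
  -- words rewritten in `S`.
  refine ⟨32 * B + (3 * n * K + n) + 1, hC, fun x D hD => ⟨?_, ?_⟩⟩
  · obtain ⟨w, hw, rfl, hl⟩ := exists_word hcl x
    have h := hD.carets_le (BlockBound.list_prod w fun g hg => hK g (hw g hg))
    rw [hl] at h
    set ℓ := wordLength S w.prod
    have hlog : Real.log D.carets ≤ n * (3 * (K * ℓ) + 1) := by
      rcases Nat.eq_zero_or_pos D.carets with h0 | h0
      · rw [h0, Nat.cast_zero, Real.log_zero]; positivity
      calc Real.log D.carets ≤ Real.log ((2 : ℝ) ^ (n * (3 * (K * ℓ) + 1))) :=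
            Real.log_le_log (by exact_mod_cast h0) (by exact_mod_cast h)
        _ = (n * (3 * (K * ℓ) + 1)) * Real.log 2 := by rw [Real.log_pow]; push_cast; ring
        _ ≤ (n * (3 * (K * ℓ) + 1)) * 1 := by
            have := Real.log_two_lt_d9
            gcongr
            linarith
        _ = n * (3 * (K * ℓ) + 1) := mul_one _
    have h1 : (0 : ℝ) ≤ (32 * B + n + 1) * ℓ := by positivity
    have h2 : (0 : ℝ) ≤ 32 * B + 3 * n * K + 1 := by positivity
    linarith
  · have hb : D.toTreePair.source.carets + 1 ≤ 2 ^ (Nat.log 2 D.carets + 1) :=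
      Nat.lt_pow_succ_log_self (by norm_num) _
    obtain ⟨w, hw, rfl, hl⟩ := exists_word_of_represents x D.toTreePair hD.1 hb
    have hlen : (w.length : ℝ) ≤ 32 * (D.carets * Real.log D.carets) + 12 := by
      refine le_trans ?_ (succ_mul_log_le D.carets)
      exact_mod_cast hl
    have hpos : 0 ≤ (D.carets * Real.log D.carets : ℝ) :=
      mul_nonneg (Nat.cast_nonneg _) (Real.log_natCast_nonneg _)
    calc (wordLength S w.prod : ℝ) ≤ B * w.length := by exact_mod_cast hB w hw
      _ ≤ B * (32 * (D.carets * Real.log D.carets) + 12) := by gcongr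
      _ ≤ _ := by
        have h1 : 0 ≤ ((3 * n * K + n) + 1 : ℝ) * (D.carets * Real.log D.carets) := by positivity
        have h2 : (0 : ℝ) ≤ 20 * B + 3 * n * K + n + 1 := by positivity
        linarith

theorem closure_moves (n : ℕ) [NeZero n] : Subgroup.closure (moves n) = ⊤ := by
  rw [eq_top_iff]
  intro x _
  obtain ⟨D, hD⟩ := exists_isReducedFor x
  have hb : D.toTreePair.source.carets + 1 ≤ 2 ^ (D.toTreePair.source.carets + 1) :=
    Nat.lt_two_pow_self.le
  obtain ⟨w, hw, rfl, -⟩ := exists_word_of_represents x D.toTreePair hD.1 hb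
  refine list_prod_mem fun g hg => ?_
  rcases hw g hg with h | h
  · exact Subgroup.subset_closure h
  · exact (Subgroup.inv_mem_iff _).1 (Subgroup.subset_closure h)

end WordLength

end HigherThompson

theorem mainTheorem3 :
    -- Brin's generating set of `2V`
    (Subgroup.closure brinGenerators = ⊤ ∧
      (∀ x : nV 2, ∃ D : GridDiagram 2, D.IsReducedFor (x : Equiv.Perm (Cube 2))) ∧
      ∃ C : ℝ, 0 < C ∧
        ∀ (x : nV 2) (D : GridDiagram 2), D.IsReducedFor (x : Equiv.Perm (Cube 2)) →
          Real.log D.carets ≤ C * wordLength brinGenerators x + C ∧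
          (wordLength brinGenerators x : ℝ) ≤ C * (D.carets * Real.log D.carets) + C) ∧
    -- all `nV`, with respect to any finite generating set
    ∀ n : ℕ, 1 ≤ n →
      Group.FG (nV n) ∧
      (∀ x : nV n, ∃ D : GridDiagram n, D.IsReducedFor (x : Equiv.Perm (Cube n))) ∧
      ∀ S : Set (nV n), S.Finite → Subgroup.closure S = ⊤ →
        ∃ C : ℝ, 0 < C ∧
          ∀ (x : nV n) (D : GridDiagram n), D.IsReducedFor (x : Equiv.Perm (Cube n)) →
            Real.log D.carets ≤ C * wordLength S x + C ∧
            (wordLength S x : ℝ) ≤ C * (D.carets * Real.log D.carets) + C := by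
  refine ⟨⟨closure_brinGenerators, exists_isReducedFor,
    exists_wordLength_bounds finite_brinGenerators closure_brinGenerators⟩, fun n hn => ?_⟩
  have : NeZero n := ⟨by omega⟩
  exact ⟨Group.fg_iff.2 ⟨moves n, closure_moves n, finite_moves n⟩, exists_isReducedFor,
    fun S hS hcl => exists_wordLength_bounds hS hcl⟩
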